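/- **Setting.** For probability measures $P,Q$ on the same space let $$T(P,Q)(\alpha)=\inf_\phi\{1-\mathbb E_Q[\phi] : \mathbb E_P[\phi]\le\alpha\},\qquad \alpha\in[0,1],$$ the infimum being over measurable $\phi$ with values in $[0,1]$. A trade-off function is a convex, continuous, non-increasing $f:[0,1]\to[0,1]$ with $0\le f(x)\le 1-x$; its inverse is $f^{-1}(\alpha)=\inf\{t\in[0,1]: f(t)\le\alpha\}$ and $f$ is symmetric if $f^{-1}=f$. Let $\Phi$ be the standard normal distribution function and $G_\mu=T(\mathcal N(0,1),\mathcal N(\mu,1))$. **Mechanism.** Fix $N,m,s,E,n\in\mathbb N$, a clipping constant $C>0$, $\sigma>0$, step sizes $\eta_t$, an initial model $w\in\mathbb R^n$ and an algorithm $\mathcal A$ with values in $\mathbb R^n$ (which may depend on the round, on randomness independent of the data and of the sampling, and on previously transmitted updates). Let $\mathtt{Sample}_{s,m}$ be a random procedure that outputs sets $S_{b,h}\subseteq\{1,\dots,N\}$, $1\le b\le \lfloor N/(ms)\rfloor$, $1\le h\le m$, such that $|S_{b,h}|=s$ and, for each $b$, the $S_{b,h}$, $1\le h\le m$, are pairwise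 disjoint; its distribution is otherwise arbitrary. A data set $d$ with $|d|\le N$ is represented by assigning to its samples distinct indices in $\{1,\dots,N\}$, so that $\xi_i$ is the sample with index $i$ (indices that are left over carry no sample). The mechanism $\mathcal M$ does the following in each epoch $e=1,\dots,E$: it draws, independently of everything before, a uniformly random permutation $\pi^e$ of $\{1,\dots,N\}$, by which the data are re-indexed, and $\{S^e_{b,h}\}\leftarrow\mathtt{Sample}_{s,m}$; then in each round $b$ it computes $a_h=\mathcal A(w,\{\xi_{\pi^e(i)}\}_{i\in S^e_{b,h}})$ for $h=1,\dots,m$, forms $U=\sum_{h=1}^m[a_h]_C$ with $[x]_C=x/\max\{1,\|x\|/C\}$, adds fresh noise $\bar U=U+\mathcal N(0,(2C\sigma)^2\mathbf I)$, transmits $\bar U/m$, and replaces $w$ by $w-\eta_t\bar U/m$, where $t=(e-1)\lfloor N/(ms)\rfloor+b$. At any time the local model $w$ may be overwritten by a global model received from the server, which may depend on data-independent randomness and on the updates transmitted before. The output of $\mathcal M$ is the sequence of all transmitted updates $\bar U/m$; its law does not depend on the choice of the representation of $d$ and is denoted by $\mathcal M(d)$. **The function $f$.** For $g\in\mathbb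 N$ let $\mathcal C=\{\sqrt{\sum_{k=1}^g c_kk^2} : c_k\in\mathbb N\}$ (with $0\in\mathbb N$), and for $c\in\mathcal C$ let $$q_E(c)=\Pr\Big[c^2=\sum_{k=1}^g c_kk^2\Big],\quad c_k=\#\{(b,e):L_{b,e}=k\},\quad L_{b,e}=\#\{h:\pi^e(S^e_{b,h})\cap\{1,\dots,g\}\ne\emptyset\}.$$ For $\alpha\in[0,1]$ let $$f(\alpha)=\sum_{c\in\mathcal C}q_E(c)\,\Phi\Big(\Lambda(\alpha)\frac{\sigma}{c}-\frac{c}{2\sigma}\Big),\qquad\text{where}\qquad 1-\alpha=\sum_{c\in\mathcal C}q_E(c)\,\Phi\Big(\Lambda(\alpha)\frac{\sigma}{c}+\frac{c}{2\sigma}\Big)$$ defines $\Lambda(\alpha)\in[-\infty,\infty]$ implicitly. For $c=0$ the two $\Phi$-terms are replaced by a common number $\theta\in[0,1]$, which is $1$ if $\Lambda(\alpha)>0$, is $0$ if $\Lambda(\alpha)<0$, and is determined by the implicit equation together with $\Lambda(\alpha)$ if $\Lambda(\alpha)=0$. **Theorem.** 1. $f$ is well defined (for every $\alpha\in[0,1]$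 the implicit equation has a solution, and all solutions give the same $f(\alpha)$), and $$f(\alpha)=\inf\Big\{\sum_{c\in\mathcal C}q_E(c)G_{c/\sigma}(\alpha_c)\ :\ \alpha_c\in[0,1],\ \sum_{c\in\mathcal C}q_E(c)\alpha_c=\alpha\Big\}.$$ 2. $\mathcal M$ is $f$-DP for groups: $f$ is a trade-off function and $T(\mathcal M(d),\mathcal M(d'))\ge f$ on $[0,1]$ for all pairs of finite data sets $d,d'$ with $\max\{|d\setminus d'|,|d'\setminus d|\}\le g$ and $N=|d\cap d'|+g$. 3. Let $c^{\tt L}\ge0$ and $1\ge l\ge\sum_{c\in\mathcal C:\,c>c^{\tt L}}q_E(c)$, and put $\hat f^{\tt L}(\alpha)=G_{c^{\tt L}/\sigma}(\min\{1,\alpha+l\})$ and $f^{\tt L}=\max\{\hat f^{\tt L},(\hat f^{\tt L})^{-1}\}$. Then $f\ge f^{\tt L}\ge\hat f^{\tt L}$ on $[0,1]$. Moreover there is exactly one $\beta\in[0,1]$ with $G_{c^{\tt L}/\sigma}(\beta)-l=\beta$, and $f^{\tt L}(\alpha)=G_{c^{\tt L}/\sigma}(\alpha)-l$ for $\alpha\in[0,\beta]$,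 $f^{\tt L}(\alpha)=G_{c^{\tt L}/\sigma}(\min\{1,\alpha+l\})$ for $\alpha\in[\beta,1]$. 4. Both $f$ and $f^{\tt L}$ are symmetric trade-off functions. 5. For larger $g$ (with $N$, $\mathtt{Sample}_{s,m}$, $E$ and $\sigma$ fixed) $f$ becomes smaller: if $g\le g'$, then $f_{g'}(\alpha)\le f_g(\alpha)$ for all $\alpha\in[0,1]$. -/

import Mathlib

open Set MeasureTheory ProbabilityTheory
open scoped ENNReal

noncomputable section

/-! ### Hypothesis testing and trade-off functions -/

/-- `T(P, Q)(α)`: the smallest type II error `1 - 𝔼_Q φ` of a measurable (randomized) rejection rule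
`φ` with values in `[0,1]` whose type I error `𝔼_P φ` is at most `α`. -/
def tradeoff {Y : Type*} [MeasurableSpace Y] (P Q : Measure Y) (α : ℝ) : ℝ :=
  sInf {β : ℝ | ∃ φ : Y → ℝ, Measurable φ ∧ (∀ y, φ y ∈ Icc (0 : ℝ) 1) ∧
    ∫ y, φ y ∂P ≤ α ∧ β = 1 - ∫ y, φ y ∂Q}

/-- Trade-off functions, as functions on `[0,1]` (values outside `[0,1]` are irrelevant). -/
structure IsTradeoffFunction (f : ℝ → ℝ) : Prop where
  convexOn : ConvexOn ℝ (Icc 0 1) f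
  continuousOn : ContinuousOn f (Icc 0 1)
  antitoneOn : AntitoneOn f (Icc 0 1)
  nonneg : ∀ α ∈ Icc (0 : ℝ) 1, 0 ≤ f α
  le_one_sub : ∀ α ∈ Icc (0 : ℝ) 1, f α ≤ 1 - α

/-- The inverse `f⁻¹(α) = inf {t ∈ [0,1] | f t ≤ α}` of a trade-off function. -/
def tradeoffInv (f : ℝ → ℝ) (α : ℝ) : ℝ :=
  sInf {t : ℝ | t ∈ Icc (0 : ℝ) 1 ∧ f t ≤ α}

/-- A symmetric trade-off function: one that is equal to its inverse on `[0,1]`. -/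
structure IsSymmetricTradeoffFunction (f : ℝ → ℝ) : Prop extends IsTradeoffFunction f where
  inv_eq : ∀ α ∈ Icc (0 : ℝ) 1, tradeoffInv f α = f α

/-- The Gaussian trade-off function `G_μ = T(N(0,1), N(μ,1))`. -/
def gaussianTradeoff (μ : ℝ) : ℝ → ℝ :=
  tradeoff (gaussianReal 0 1) (gaussianReal μ 1)

/-- The standard normal distribution function `Φ`, with `Φ(-∞) = 0` and `Φ(+∞) = 1`. -/
def stdNormalCdf (x : EReal) : ℝ :=
  (gaussianReal 0 1).real {y : ℝ | (y : EReal) ≤ x}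

/-! ### Sampling -/

/-- The number `N / (m s)` of rounds in an epoch. -/
abbrev roundsPerEpoch (N m s : ℕ) : ℕ := N / (m * s)

/-- The possible outputs `{S_{b,h}}` of the sampling procedure in one epoch. -/
abbrev EpochSample (N m s : ℕ) : Type :=
  Fin (roundsPerEpoch N m s) → Fin m → Finset (Fin N)

/-- A sampling procedure `Sample_{s,m}` on the index set `{1, …, N}`: a random output such that, for
each round `b`, the sets `S_{b,h}` have size `s` and are disjoint, so that they partition a set
`S_b` of size `m s`. The joint distribution is otherwise arbitrary. -/
structure Sampler (N m s : ℕ) where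
  law : PMF (EpochSample N m s)
  card_eq : ∀ S ∈ law.support, ∀ b h, (S b h).card = s
  disjoint : ∀ S ∈ law.support, ∀ b h h', h ≠ h' → Disjoint (S b h) (S b h')

/-- The probability that the permutations `π^e` of the `E` epochs and the outputs of the sampling
procedure in the `E` epochs take the given values: all of them are independent, and the
permutations are uniformly distributed. -/
def drawProb {N m s E : ℕ} (smp : Sampler N m s)
    (π : Fin E → Equiv.Perm (Fin N)) (S : Fin E → EpochSample N m s) : ℝ≥0∞ :=
  ∏ e, PMF.uniformOfFintype (Equiv.Perm (Fin N)) (π e) * smp.law (S e)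

/-- `L_{b,e} = #{h | π^e(S^e_{b,h}) ∩ {1, …, g} ≠ ∅}`; the indices `1, …, g` are the first `g`
elements of `Fin N`. -/
def hitCount {N m s E : ℕ} (g : ℕ) (π : Fin E → Equiv.Perm (Fin N))
    (S : Fin E → EpochSample N m s) (b : Fin (roundsPerEpoch N m s)) (e : Fin E) : ℕ :=
  (Finset.univ.filter fun h : Fin m => ∃ i ∈ S e b h, (π e i : ℕ) < g).card

/-- `c_k = #{(b,e) | L_{b,e} = k}`. -/
def roundCount {N m s E : ℕ} (g : ℕ) (π : Fin E → Equiv.Perm (Fin N))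
    (S : Fin E → EpochSample N m s) (k : ℕ) : ℕ :=
  (Finset.univ.filter fun p : Fin (roundsPerEpoch N m s) × Fin E =>
    hitCount g π S p.1 p.2 = k).card

/-- `𝒞 = {√(∑_{k=1}^g c_k k²) | c_k ∈ ℕ}`. -/
def sensSet (g : ℕ) : Set ℝ :=
  {c : ℝ | ∃ a : ℕ → ℕ, c = √(∑ k ∈ Finset.Icc 1 g, (a k : ℝ) * (k : ℝ) ^ 2)}

open Classical in
/-- `q_E(c)`: the probability that `c² = ∑_{k=1}^g c_k k²`. -/
def sensProb {N m s : ℕ} (smp : Sampler N m s) (E g : ℕ) (c : ℝ) : ℝ :=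
  (∑ π : Fin E → Equiv.Perm (Fin N), ∑ S : Fin E → EpochSample N m s,
    if c ^ 2 = ∑ k ∈ Finset.Icc 1 g, (roundCount g π S k : ℝ) * (k : ℝ) ^ 2
      then drawProb smp π S else 0).toReal

/-! ### The trade-off function `f` -/

/-- `Φ(Λ σ / c + ε c / (2 σ))` for `c > 0`. For `c = 0` it is read as the limit `c → 0`, that is `1`
for `Λ > 0`, `0` for `Λ < 0` and undetermined in `[0,1]` for `Λ = 0`; this value is the separate
parameter `θ`. -/
def shiftedCdf (σ : ℝ) (Λ : EReal) (θ ε c : ℝ) : ℝ :=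
  if c = 0 then θ
  else stdNormalCdf (Λ * ((σ / c : ℝ) : EReal) + ((ε * (c / (2 * σ)) : ℝ) : EReal))

/-- `Λ = Λ(α)` (with the value `θ` for `c = 0`) solves the implicit equation
`1 - α = ∑_{c ∈ 𝒞} q(c) Φ(Λ σ / c + c / (2 σ))`. -/
structure IsThreshold (𝒞 : Set ℝ) (q : ℝ → ℝ) (σ α : ℝ) (Λ : EReal) (θ : ℝ) : Prop where
  mem : θ ∈ Icc (0 : ℝ) 1
  eq_one : 0 < Λ → θ = 1
  eq_zero : Λ < 0 → θ = 0
  eq : 1 - α = ∑' c : 𝒞, q c * shiftedCdf σ Λ θ 1 c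

/-- `∑_{c ∈ 𝒞} q(c) Φ(Λ σ / c - c / (2 σ))`. -/
def thresholdValue (𝒞 : Set ℝ) (q : ℝ → ℝ) (σ : ℝ) (Λ : EReal) (θ : ℝ) : ℝ :=
  ∑' c : 𝒞, q c * shiftedCdf σ Λ θ (-1) c

open Classical in
/-- The function `f(α) = ∑_{c ∈ 𝒞} q(c) Φ(Λ(α) σ / c - c / (2 σ))`, with `Λ(α)` a solution of the
implicit equation. -/
def mixtureTradeoff (𝒞 : Set ℝ) (q : ℝ → ℝ) (σ α : ℝ) : ℝ :=
  if h : ∃ p : EReal × ℝ, IsThreshold 𝒞 q σ α p.1 p.2 then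
    thresholdValue 𝒞 q σ h.choose.1 h.choose.2
  else 0

/-- The function `f` for `q = q_E`. -/
def sampledTradeoff {N m s : ℕ} (smp : Sampler N m s) (E g : ℕ) (σ : ℝ) : ℝ → ℝ :=
  mixtureTradeoff (sensSet g) (sensProb smp E g) σ

/-! ### The lower bounds -/

/-- `\hat f^L(α) = G_{c/σ}(min {1, α + l})`. -/
def lowerHat (σ c l α : ℝ) : ℝ := gaussianTradeoff (c / σ) (min 1 (α + l))

/-- `f^L = max {\hat f^L, (\hat f^L)⁻¹}`. -/
def lowerBound (σ c l α : ℝ) : ℝ := max (lowerHat σ c l α) (tradeoffInv (lowerHat σ c l) α)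

/-! ### The training mechanism -/

/-- The space `ℝⁿ` of models and of updates, with the Euclidean norm. -/
abbrev ModelSpace (n : ℕ) : Type := EuclideanSpace ℝ (Fin n)

/-- The clipping operation `[x]_C = x / max {1, ‖x‖ / C}`. -/
def clip {n : ℕ} (C : ℝ) (x : ModelSpace n) : ModelSpace n := (max 1 (‖x‖ / C))⁻¹ • x

/-- The client's program, up to sampling, clipping and noise. `Ω` is the space of all data-independent
randomness: the coins of the algorithm `𝒜` and the timing and contents of the server's messages.
The server and the interrupt service routine can also react to the updates that the client has
transmitted so far, which are passed as a sequence `y : ℕ → ℝⁿ` (padded with zeros).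

* `update t h ω y w ξ` is the result `a_h` of running `𝒜` in round `t` on the model `w` and on the
  samples `ξ`; here `ξ i` is the sample with index `i`, and `none` if there is none;
* `isr t h ω y w` is what the interrupt service routine makes of the local model `w` in round `t`
  before the `h`-th computation, `0 ≤ h < m` (for `h = m`: after the transmission and before the
  local model update); it is `w` if no global model has been received;
* `init` is the initial model and `stepSize t` the step size of round `t`. -/
structure LocalProgram (X Ω : Type*) [MeasurableSpace Ω] (n N : ℕ) where
  init : ModelSpace n
  stepSize : ℕ → ℝ
  isr : ℕ → ℕ → Ω → (ℕ → ModelSpace n) → ModelSpace n → ModelSpace n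
  update : ℕ → ℕ → Ω → (ℕ → ModelSpace n) → ModelSpace n → (Fin N → Option X) → ModelSpace n
  measurable_isr : ∀ t h, Measurable
    fun p : Ω × (ℕ → ModelSpace n) × ModelSpace n => isr t h p.1 p.2.1 p.2.2
  measurable_update : ∀ t h ξ, Measurable
    fun p : Ω × (ℕ → ModelSpace n) × ModelSpace n => update t h p.1 p.2.1 p.2.2 ξ

namespace LocalProgram

variable {X Ω : Type*} [MeasurableSpace Ω] {n N : ℕ}

/-- The local model after the first `h` calls of the interrupt service routine in round `t`, if the
round starts with model `w`. -/
def roundModel (A : LocalProgram X Ω n N) (t : ℕ) (ω : Ω) (y : ℕ → ModelSpace n)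
    (w : ModelSpace n) : ℕ → ModelSpace n
  | 0 => w
  | h + 1 => A.isr t h ω y (A.roundModel t ω y w h)

/-- One round `t`, with noise `z` and with the sample families `ξ h`, `h = 1, …, m`: from the updates
transmitted so far and the local model to the same data after the round. It computes
`U = ∑_h [a_h]_C` and `Ū = U + z`, transmits `Ū / m` and replaces `w` by `w - η_t Ū / m`. -/
def round (A : LocalProgram X Ω n N) (m : ℕ) (C : ℝ) (t : ℕ) (ω : Ω) (z : ModelSpace n)
    (ξ : Fin m → Fin N → Option X) (st : (ℕ → ModelSpace n) × ModelSpace n) :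
    (ℕ → ModelSpace n) × ModelSpace n :=
  let U := ∑ h : Fin m, clip C (A.update t h ω st.1 (A.roundModel t ω st.1 st.2 (h + 1)) (ξ h))
  let V := (m : ℝ)⁻¹ • (U + z)
  let y := Function.update st.1 t V
  (y, A.isr t m ω y (A.roundModel t ω st.1 st.2 m) - A.stepSize t • V)

/-- The transmitted updates of all `E · N/(m s)` rounds, for given permutations `π`, sampled index
sets `S`, randomness `ω` and noise `z`, if `r i` is the data sample with index `i`. In epoch `e` the
data are re-indexed as `r ∘ π^e`, and `𝒜` is run on the samples with (new) index in `S^e_{b,h}`. -/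
def transmitted {m s E : ℕ} (A : LocalProgram X Ω n N) (C : ℝ) (r : Fin N → Option X)
    (π : Fin E → Equiv.Perm (Fin N)) (S : Fin E → EpochSample N m s)
    (ω : Ω) (z : Fin (E * roundsPerEpoch N m s) → Fin n → ℝ) :
    Fin (E * roundsPerEpoch N m s) → ModelSpace n :=
  fun j => (Fin.foldl (E * roundsPerEpoch N m s)
    (fun st t =>
      let e := (finProdFinEquiv.symm t).1
      let b := (finProdFinEquiv.symm t).2
      A.round m C t ω (WithLp.toLp 2 (z t))
        (fun h i => if i ∈ S e b h then r (π e i) else none) st)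
    ((0 : ℕ → ModelSpace n), A.init)).1 j

/-- The mechanism `ℳ`: the distribution of the sequence of transmitted updates. The permutations and
the index sets are drawn as in `drawProb`, independently of the randomness `ω ∼ ρ`, and the noise
has independent entries with distribution `N(0, (2 C σ)²)`. -/
def mechanism {m s : ℕ} (A : LocalProgram X Ω n N) (ρ : Measure Ω) (smp : Sampler N m s) (E : ℕ)
    (C σ : ℝ) (r : Fin N → Option X) :
    Measure (Fin (E * roundsPerEpoch N m s) → ModelSpace n) :=
  ∑ π : Fin E → Equiv.Perm (Fin N), ∑ S : Fin E → EpochSample N m s,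
    drawProb smp π S •
      (ρ.prod (Measure.pi fun _ : Fin (E * roundsPerEpoch N m s) =>
          Measure.pi fun _ : Fin n => gaussianReal 0 ((2 * C * σ) ^ 2).toNNReal)).map
        fun p => A.transmitted C r π S p.1 p.2

end LocalProgram

/-! ### Differential privacy for groups -/

/-- `r` is a representation of the data set `d` by indices in `{1, …, N}`: every sample of `d` has
exactly one index, and the indices that are left over (if `|d| < N`) carry no sample. -/
structure Represents {X : Type*} {N : ℕ} (r : Fin N → Option X) (d : Finset X) : Prop where
  mem_iff : ∀ x, x ∈ d ↔ ∃ i, r i = some x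
  inj : ∀ i j x, r i = some x → r j = some x → i = j

/-- The mechanism `M`, with index set `{1, …, N}`, is `f`-DP for all pairs of data sets `d`, `d'` with
`max {|d \ d'|, |d' \ d|} ≤ g` and `N = |d ∩ d'| + g`. -/
structure IsGroupDP {X Y : Type*} [DecidableEq X] [MeasurableSpace Y] {N : ℕ}
    (M : (Fin N → Option X) → Measure Y) (g : ℕ) (f : ℝ → ℝ) : Prop where
  isTradeoffFunction : IsTradeoffFunction f
  le_tradeoff : ∀ d d' : Finset X, max (d \ d').card (d' \ d).card ≤ g → N = (d ∩ d').card + g →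
    ∀ r r' : Fin N → Option X, Represents r d → Represents r' d' →
      ∀ α ∈ Icc (0 : ℝ) 1, f α ≤ tradeoff (M r) (M r') α

end

noncomputable section

/-! Everything is expressed through Bayes risks. If a type I error costs `k`, testing `P` against
`Q` has the minimal risk `F k = min_φ (1 - E_Q φ + k E_P φ)`, and the trade-off function is the
supremum of the lines `F k - k α` (`IsConjugate`). Inequalities between trade-off functions then
follow from inequalities between risks, a mixture whose component is revealed has the averaged risk,
and symmetry follows from the functional equation `F k = k F(1/k)`.

The Gaussian input is that two independent observations with separations `v` and `s` are worth one
observation with separation `√(v² + s²)` (`lintegral_gaussianBayes`), because the log-likelihood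
ratio depends on them only through `v z + s x`. Hence the risk decreases in the separation
(`gaussianBayes_anti`), and an induction over coordinates and rounds gives adaptive composition
(`gaussianBayes_le_foldl`).

By the uniform permutations, the common samples may be assumed to have the indices from `g` on
(`mechanism_comp_perm`, `exists_perm_agree`). For a fixed draw, a round then shifts the noise by at
most `2 C L_{b,e}`, which is `L_{b,e} / σ` standard deviations, so the total separation is at most
`c / σ` with `c² = ∑ L_{b,e}²`. Averaging over the draws bounds the risk of the mechanism from below
by `mixtureRisk` (`mixtureRisk_le_mechanism`).

The closed form of `f` is strong duality for this mixture: likelihood ratio tests with one common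
threshold `exp Λ` in all components attain the supremum over prices and the infimum over the levels
`α_c` (`isLUB_thresholdValue`, `isGLB_thresholdValue`). That all solutions `Λ` give the same value
is uniqueness of the least upper bound. The function `f^L` is the conjugate of `max 0 (F k - l
min(1,k))`, so `f ≥ f^L` and the monotonicity in `g` also reduce to comparing risks. -/

/-! ### Shifts of the standard Gaussian measure -/

/-- The density of `N(v, 1)` with respect to `N(0, 1)`. -/
def gaussianLikelihood (v x : ℝ) : ℝ≥0∞ := ENNReal.ofReal (Real.exp (v * x - v ^ 2 / 2))

lemma measurable_gaussianLikelihood (v : ℝ) : Measurable (gaussianLikelihood v) := by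
  unfold gaussianLikelihood; fun_prop

@[simp] lemma gaussianLikelihood_zero (x : ℝ) : gaussianLikelihood 0 x = 1 := by
  simp [gaussianLikelihood]

lemma lintegral_gaussianReal_eq_likelihood (v : ℝ) {h : ℝ → ℝ≥0∞} (hh : Measurable h) :
    ∫⁻ x, h x ∂gaussianReal v 1 = ∫⁻ x, gaussianLikelihood v x * h x ∂gaussianReal 0 1 := by
  have hm : Measurable fun x => gaussianLikelihood v x * h x :=
    (measurable_gaussianLikelihood v).mul hh
  rw [gaussianReal_of_var_ne_zero _ one_ne_zero, gaussianReal_of_var_ne_zero _ one_ne_zero,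
    lintegral_withDensity_eq_lintegral_mul _ (measurable_gaussianPDF _ _) hh,
    lintegral_withDensity_eq_lintegral_mul _ (measurable_gaussianPDF _ _) hm]
  refine lintegral_congr fun x => ?_
  simp only [Pi.mul_apply, ← mul_assoc]
  congr 1
  rw [gaussianPDF, gaussianPDF, gaussianLikelihood,
    ← ENNReal.ofReal_mul (gaussianPDFReal_nonneg _ _ _), gaussianPDFReal, gaussianPDFReal,
    mul_assoc (√_)⁻¹, ← Real.exp_add]
  congr 3
  simp
  ring

lemma lintegral_gaussianReal_shift (v : ℝ) {h : ℝ → ℝ≥0∞} (hh : Measurable h) :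
    ∫⁻ x, h (v + x) ∂gaussianReal 0 1 = ∫⁻ x, gaussianLikelihood v x * h x ∂gaussianReal 0 1 := by
  rw [← lintegral_gaussianReal_eq_likelihood v hh, ← lintegral_map hh (measurable_const_add v),
    gaussianReal_map_const_add, zero_add]

lemma lintegral_gaussianLikelihood (v : ℝ) :
    ∫⁻ x, gaussianLikelihood v x ∂gaussianReal 0 1 = 1 := by
  have := lintegral_gaussianReal_eq_likelihood v (h := fun _ => 1) measurable_const
  simpa using this.symm

lemma lintegral_gaussianReal_neg {h : ℝ → ℝ≥0∞} (hh : Measurable h) :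
    ∫⁻ x, h (-x) ∂gaussianReal 0 1 = ∫⁻ x, h x ∂gaussianReal 0 1 := by
  rw [← lintegral_map hh measurable_neg, gaussianReal_map_neg, neg_zero]

/-! ### The Bayes risk of the Gaussian testing problem -/

/-- The minimal Bayes risk `min_φ (a 𝔼_{N(s,1)} (1 - φ) + b 𝔼_{N(0,1)} φ)` of a test. -/
def gaussianBayes (s : ℝ) (a b : ℝ≥0∞) : ℝ≥0∞ :=
  ∫⁻ x, min (a * gaussianLikelihood s x) b ∂gaussianReal 0 1

lemma measurable_gaussianBayes_integrand (s : ℝ) (a b : ℝ≥0∞) :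
    Measurable fun x => min (a * gaussianLikelihood s x) b :=
  ((measurable_gaussianLikelihood s).const_mul a).min measurable_const

@[simp] lemma gaussianBayes_zero (a b : ℝ≥0∞) : gaussianBayes 0 a b = min a b := by
  simp [gaussianBayes]

lemma gaussianBayes_le (s : ℝ) (a b : ℝ≥0∞) : gaussianBayes s a b ≤ min a b := by
  refine le_min ?_ ?_
  · calc gaussianBayes s a b ≤ ∫⁻ x, a * gaussianLikelihood s x ∂gaussianReal 0 1 :=
        lintegral_mono fun x => min_le_left _ _
      _ = a := by
        rw [lintegral_const_mul _ (measurable_gaussianLikelihood s),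
          lintegral_gaussianLikelihood, mul_one]
  · calc gaussianBayes s a b ≤ ∫⁻ _, b ∂gaussianReal 0 1 :=
        lintegral_mono fun x => min_le_right _ _
      _ = b := by simp

lemma gaussianBayes_mul (s : ℝ) (a b k : ℝ≥0∞) :
    gaussianBayes s (k * a) (k * b) = k * gaussianBayes s a b := by
  rw [gaussianBayes, gaussianBayes,
    ← lintegral_const_mul _ (measurable_gaussianBayes_integrand s a b)]
  refine lintegral_congr fun x => ?_
  rw [mul_assoc, (mul_right_mono (a := k)).map_min]

/-- The reflection `x ↦ s - x` exchanges `N(0,1)` and `N(s,1)`; on likelihoods this is `L(x) L(s -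
x) = 1`. The symmetry of `f` and `f^L` has its origin here. -/
lemma gaussianBayes_comm (s : ℝ) (a b : ℝ≥0∞) : gaussianBayes s a b = gaussianBayes s b a := by
  have key : ∀ x, min (a * gaussianLikelihood s x) b
      = gaussianLikelihood s x * min a (b * gaussianLikelihood s (s - x)) := by
    intro x
    rw [(mul_right_mono (a := gaussianLikelihood s x)).map_min, mul_comm a]
    congr 1
    rw [mul_left_comm, gaussianLikelihood, gaussianLikelihood,
      ← ENNReal.ofReal_mul (Real.exp_nonneg _), ← Real.exp_add]
    ring_nf
    simp
  have hm : Measurable fun x => min a (b * gaussianLikelihood s (s - x)) :=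
    measurable_const.min (((measurable_gaussianLikelihood s).comp
      (measurable_const.sub measurable_id)).const_mul b)
  have hm' : Measurable fun x => min a (b * gaussianLikelihood s (-x)) :=
    measurable_const.min (((measurable_gaussianLikelihood s).comp measurable_neg).const_mul b)
  calc gaussianBayes s a b
      = ∫⁻ x, min a (b * gaussianLikelihood s (s - (s + x))) ∂gaussianReal 0 1 := by
        rw [lintegral_gaussianReal_shift s hm]
        exact lintegral_congr key
    _ = ∫⁻ x, min a (b * gaussianLikelihood s (-x)) ∂gaussianReal 0 1 := by
        simp only [sub_add_cancel_left]
    _ = ∫⁻ x, min a (b * gaussianLikelihood s (- -x)) ∂gaussianReal 0 1 :=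
        (lintegral_gaussianReal_neg hm').symm
    _ = gaussianBayes s b a := by simp only [neg_neg, min_comm a]; rfl

lemma map_gaussianReal_prod (v s : ℝ) :
    ((gaussianReal 0 1).prod (gaussianReal 0 1)).map (fun p : ℝ × ℝ => v * p.1 + s * p.2)
      = (gaussianReal 0 1).map (fun x => √(v ^ 2 + s ^ 2) * x) := by
  have h1 : (fun p : ℝ × ℝ => v * p.1 + s * p.2)
      = (fun p : ℝ × ℝ => p.1 + p.2) ∘ Prod.map (v * ·) (s * ·) := rfl
  rw [h1, ← Measure.map_map (by fun_prop) (by fun_prop),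
    ← Measure.map_prod_map _ _ (by fun_prop) (by fun_prop), gaussianReal_map_const_mul,
    gaussianReal_map_const_mul, gaussianReal_map_const_mul]
  have h2 := gaussianReal_conv_gaussianReal (m₁ := v * 0) (m₂ := s * 0)
    (v₁ := NNReal.mk (v ^ 2) (sq_nonneg _) * 1)
    (v₂ := NNReal.mk (s ^ 2) (sq_nonneg _) * 1)
  rw [Measure.conv] at h2
  rw [h2]
  congr 1
  · simp
  · ext
    simp [Real.sq_sqrt (add_nonneg (sq_nonneg v) (sq_nonneg s))]

/-- The product of the two likelihoods is `exp (v z + s x - r²/2)` with `r² = v² + s²`, and `v z + s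
x` is distributed like `r` times one standard normal variable. So observing both `z` and `x` is
equivalent to one observation with separation `r`. -/
lemma lintegral_gaussianBayes (v s : ℝ) (a b : ℝ≥0∞) :
    ∫⁻ z, gaussianBayes s (a * gaussianLikelihood v z) b ∂gaussianReal 0 1
      = gaussianBayes (√(v ^ 2 + s ^ 2)) a b := by
  set r := √(v ^ 2 + s ^ 2)
  have hr : r ^ 2 = v ^ 2 + s ^ 2 := Real.sq_sqrt (by positivity)
  let H : ℝ → ℝ≥0∞ := fun y => min (a * ENNReal.ofReal (Real.exp (y - r ^ 2 / 2))) b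
  have hH : Measurable H := by fun_prop
  calc ∫⁻ z, gaussianBayes s (a * gaussianLikelihood v z) b ∂gaussianReal 0 1
      = ∫⁻ z, ∫⁻ x, H (v * z + s * x) ∂gaussianReal 0 1 ∂gaussianReal 0 1 := by
        refine lintegral_congr fun z => lintegral_congr fun x => ?_
        simp only [H, gaussianLikelihood]
        rw [mul_assoc, ← ENNReal.ofReal_mul (Real.exp_nonneg _), ← Real.exp_add, hr]
        congr 4
        ring
    _ = ∫⁻ p, H (v * p.1 + s * p.2) ∂(gaussianReal 0 1).prod (gaussianReal 0 1) :=
        (lintegral_prod (fun p : ℝ × ℝ => H (v * p.1 + s * p.2))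
          (hH.comp (by fun_prop)).aemeasurable).symm
    _ = ∫⁻ x, H (r * x) ∂gaussianReal 0 1 := by
        rw [← lintegral_map hH (by fun_prop), map_gaussianReal_prod, lintegral_map hH (by fun_prop)]
    _ = gaussianBayes r a b := rfl

/-- Separation `t` amounts to two observations with separations `s` and `√(t² - s²)`; ignoring the
second one cannot lower the risk. -/
lemma gaussianBayes_anti {s t : ℝ} (hs : 0 ≤ s) (hst : s ≤ t) (a b : ℝ≥0∞) :
    gaussianBayes t a b ≤ gaussianBayes s a b := by
  have h : t = √(s ^ 2 + √(t ^ 2 - s ^ 2) ^ 2) := by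
    rw [Real.sq_sqrt (by nlinarith), add_sub_cancel, Real.sqrt_sq (hs.trans hst)]
  rw [h, ← lintegral_gaussianBayes]
  exact lintegral_mono fun x => gaussianBayes_le _ _ _

/-- Testing two Gaussians with a shift, when the continuation after observing `z` has a Bayes risk
of at least `gaussianBayes s`. -/
lemma gaussianBayes_le_lintegral_add (v s : ℝ) {G₁ G₂ : ℝ → ℝ≥0∞} (h₁ : Measurable G₁)
    (h₂ : Measurable G₂)
    (h : ∀ z, ∀ a b : ℝ≥0∞, gaussianBayes s a b ≤ a * G₁ z + b * G₂ z) (a b : ℝ≥0∞) :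
    gaussianBayes (√(v ^ 2 + s ^ 2)) a b
      ≤ a * ∫⁻ z, G₁ (v + z) ∂gaussianReal 0 1 + b * ∫⁻ z, G₂ z ∂gaussianReal 0 1 := by
  have hm : Measurable fun x => gaussianLikelihood v x * G₁ x :=
    (measurable_gaussianLikelihood v).mul h₁
  rw [lintegral_gaussianReal_shift v h₁, ← lintegral_const_mul _ h₂, ← lintegral_const_mul _ hm,
    ← lintegral_add_right _ (h₂.const_mul b), ← lintegral_gaussianBayes]
  refine lintegral_mono fun z => ?_
  rw [← mul_assoc]
  exact h z _ _

/-! ### The standard normal distribution function -/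

lemma stdNormalCdf_coe (x : ℝ) : stdNormalCdf x = cdf (gaussianReal 0 1) x := by
  simp only [stdNormalCdf, EReal.coe_le_coe_iff, cdf_eq_real]; rfl

lemma stdNormalCdf_top : stdNormalCdf ⊤ = 1 := by simp [stdNormalCdf]

lemma stdNormalCdf_bot : stdNormalCdf ⊥ = 0 := by simp [stdNormalCdf]

lemma stdNormalCdf_mem_Icc (x : EReal) : stdNormalCdf x ∈ Icc (0 : ℝ) 1 :=
  ⟨measureReal_nonneg, measureReal_le_one⟩

lemma continuous_cdf_gaussianReal : Continuous (cdf (gaussianReal 0 1)) := by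
  have : NullSingletonClass (gaussianReal 0 1) := nullSingletonClass_gaussianReal one_ne_zero
  refine continuous_iff_continuousAt.2 fun x => ?_
  rw [(monotone_cdf _).continuousAt_iff_leftLim_eq_rightLim, StieltjesFunction.rightLim_eq]
  refine le_antisymm ((monotone_cdf _).leftLim_le le_rfl) ?_
  have h := (cdf (gaussianReal 0 1)).measure_singleton x
  rw [measure_cdf, measure_singleton] at h
  linarith [ENNReal.ofReal_eq_zero.1 h.symm]

/-- A threshold test. -/
lemma gaussianBayes_exp {μ : ℝ} (hμ : 0 ≤ μ) (t : ℝ) :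
    gaussianBayes μ 1 (gaussianLikelihood μ t)
      = ENNReal.ofReal (cdf (gaussianReal 0 1) (t - μ))
        + gaussianLikelihood μ t * ENNReal.ofReal (1 - cdf (gaussianReal 0 1) t) := by
  -- Monotonicity of the likelihood ratio decides the minimum: its first argument is the smaller one
  -- up to `t`, its second argument beyond `t`.
  have hmono : Monotone (gaussianLikelihood μ) := fun x y hxy =>
    ENNReal.ofReal_le_ofReal (Real.exp_le_exp.2 (by nlinarith))
  have h1 : ∫⁻ x in Iic t, gaussianLikelihood μ x ∂gaussianReal 0 1
      = ENNReal.ofReal (cdf (gaussianReal 0 1) (t - μ)) := by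
    have hm : Measurable ((Iic t).indicator (1 : ℝ → ℝ≥0∞)) :=
      measurable_one.indicator measurableSet_Iic
    have h := lintegral_gaussianReal_shift μ hm
    rw [ofReal_cdf, ← lintegral_indicator_one measurableSet_Iic, ← lintegral_indicator measurableSet_Iic]
    calc _ = ∫⁻ x, gaussianLikelihood μ x * (Iic t).indicator 1 x ∂gaussianReal 0 1 := by
          refine lintegral_congr fun x => ?_
          by_cases hx : x ∈ Iic t <;> simp [hx]
      _ = _ := by
          rw [← h]
          refine lintegral_congr fun x => ?_
          simp [indicator, le_sub_iff_add_le']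
  have h2 : gaussianReal 0 1 (Iic t)ᶜ = ENNReal.ofReal (1 - cdf (gaussianReal 0 1) t) := by
    rw [prob_compl_eq_one_sub measurableSet_Iic, ENNReal.ofReal_sub _ (cdf_nonneg _ _), ofReal_cdf,
      ENNReal.ofReal_one]
  rw [gaussianBayes, ← lintegral_add_compl _ (measurableSet_Iic (a := t)), ← h1, ← h2]
  congr 1
  · refine setLIntegral_congr_fun measurableSet_Iic fun x hx => ?_
    simp only [one_mul]
    exact min_eq_left (hmono hx)
  · rw [← setLIntegral_const]
    refine setLIntegral_congr_fun measurableSet_Iic.compl fun x hx => ?_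
    simp only [one_mul]
    exact min_eq_right (hmono (le_of_lt (by simpa using hx)))

/-- The standard normal distribution function on the real line. -/
abbrev stdCdf : ℝ → ℝ := cdf (gaussianReal 0 1)

/-! ### Weak duality for tests -/

lemma lintegral_test_eq {Y : Type*} [MeasurableSpace Y] (P Q : Measure Y) [IsProbabilityMeasure P]
    [IsProbabilityMeasure Q] {φ : Y → ℝ} (hφ : Measurable φ) (h01 : ∀ y, φ y ∈ Icc (0 : ℝ) 1)
    {k : ℝ} (hk : 0 ≤ k) :
    1 * ∫⁻ y, ENNReal.ofReal (1 - φ y) ∂Q + ENNReal.ofReal k * ∫⁻ y, ENNReal.ofReal (φ y) ∂P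
      = ENNReal.ofReal ((1 - ∫ y, φ y ∂Q) + k * ∫ y, φ y ∂P) := by
  have hint : ∀ (R : Measure Y) [IsProbabilityMeasure R], Integrable φ R := fun R _ =>
    Integrable.of_bound hφ.aestronglyMeasurable 1 (Filter.Eventually.of_forall fun y => by
      rw [Real.norm_eq_abs, abs_of_nonneg (h01 y).1]; exact (h01 y).2)
  have h1 : ∫ y, (1 - φ y) ∂Q = 1 - ∫ y, φ y ∂Q := by
    rw [integral_sub (integrable_const _) (hint Q)]; simp
  have h2 : 0 ≤ ∫ y, (1 - φ y) ∂Q := integral_nonneg fun y => sub_nonneg.2 (h01 y).2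
  have h3 : 0 ≤ ∫ y, φ y ∂P := integral_nonneg fun y => (h01 y).1
  have hint' : Integrable (fun y => 1 - φ y) Q := (integrable_const _).sub (hint Q)
  rw [one_mul, ← ofReal_integral_eq_lintegral_ofReal hint'
      (Filter.Eventually.of_forall fun y => sub_nonneg.2 (h01 y).2),
    ← ofReal_integral_eq_lintegral_ofReal (hint P) (Filter.Eventually.of_forall fun y => (h01 y).1),
    ← h1, ENNReal.ofReal_add h2 (mul_nonneg hk h3), ENNReal.ofReal_mul hk]

lemma one_sub_integral_nonneg {Y : Type*} [MeasurableSpace Y] (Q : Measure Y)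
    [IsProbabilityMeasure Q] {φ : Y → ℝ} (h01 : ∀ y, φ y ∈ Icc (0 : ℝ) 1) :
    0 ≤ 1 - ∫ y, φ y ∂Q := by
  have : ∫ y, φ y ∂Q ≤ ∫ _, (1 : ℝ) ∂Q :=
    integral_mono_of_nonneg (Filter.Eventually.of_forall fun y => (h01 y).1) (integrable_const _)
      (Filter.Eventually.of_forall fun y => (h01 y).2)
  simpa using this

/-- The right side is a convex combination of `a` and `b`. Pointwise, this is the optimality of
likelihood ratio tests; it also starts the induction for adaptive composition. -/
lemma min_le_test {t : ℝ} (ht : t ∈ Icc (0 : ℝ) 1) (a b : ℝ≥0∞) :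
    min a b ≤ a * ENNReal.ofReal (1 - t) + b * ENNReal.ofReal t := by
  have hsum : ENNReal.ofReal (1 - t) + ENNReal.ofReal t = 1 := by
    rw [← ENNReal.ofReal_add (sub_nonneg.2 ht.2) ht.1]; simp
  calc min a b = min a b * ENNReal.ofReal (1 - t) + min a b * ENNReal.ofReal t := by
        rw [← mul_add, hsum, mul_one]
    _ ≤ _ := add_le_add (mul_le_mul_left (min_le_left _ _) _) (mul_le_mul_left (min_le_right _ _) _)

lemma tradeoff_set_bddBelow {Y : Type*} [MeasurableSpace Y] (P Q : Measure Y)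
    [IsProbabilityMeasure Q] (α : ℝ) :
    BddBelow {β : ℝ | ∃ φ : Y → ℝ, Measurable φ ∧ (∀ y, φ y ∈ Icc (0 : ℝ) 1) ∧
      ∫ y, φ y ∂P ≤ α ∧ β = 1 - ∫ y, φ y ∂Q} := by
  refine ⟨0, ?_⟩
  rintro _ ⟨φ, hφ, h01, -, rfl⟩
  exact one_sub_integral_nonneg Q h01

lemma le_tradeoff {Y : Type*} [MeasurableSpace Y] (P Q : Measure Y) {α v : ℝ} (hα : 0 ≤ α)
    (h : ∀ φ : Y → ℝ, Measurable φ → (∀ y, φ y ∈ Icc (0 : ℝ) 1) → ∫ y, φ y ∂P ≤ α →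
      v ≤ 1 - ∫ y, φ y ∂Q) : v ≤ tradeoff P Q α := by
  -- The test `φ = 0` is admissible since `0 ≤ α`, which excludes the default value `sInf ∅ = 0`.
  refine le_csInf ⟨1, fun _ => 0, measurable_const, fun _ => by simp, by simpa using hα, by simp⟩ ?_
  rintro _ ⟨φ, hφ, h01, hα, rfl⟩
  exact h φ hφ h01 hα

/-! ### The Bayes risk as a function of the price of a type I error -/

/-- `gaussianBayes μ 1 k` as a real number. -/
def gaussianRisk (μ k : ℝ) : ℝ := (gaussianBayes μ 1 (ENNReal.ofReal k)).toReal

lemma gaussianBayes_ne_top (μ : ℝ) {a b : ℝ≥0∞} (hb : b ≠ ∞) : gaussianBayes μ a b ≠ ∞ :=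
  ne_top_of_le_ne_top hb ((gaussianBayes_le μ a b).trans (min_le_right _ _))

lemma ofReal_gaussianRisk (μ k : ℝ) :
    ENNReal.ofReal (gaussianRisk μ k) = gaussianBayes μ 1 (ENNReal.ofReal k) :=
  ENNReal.ofReal_toReal (gaussianBayes_ne_top μ ENNReal.ofReal_ne_top)

lemma gaussianRisk_nonneg (μ k : ℝ) : 0 ≤ gaussianRisk μ k := ENNReal.toReal_nonneg

lemma gaussianRisk_le_one (μ k : ℝ) : gaussianRisk μ k ≤ 1 :=
  ENNReal.toReal_le_of_le_ofReal zero_le_one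
    (by simpa using (gaussianBayes_le μ 1 _).trans (min_le_left _ _))

lemma gaussianRisk_le (μ : ℝ) {k : ℝ} (hk : 0 ≤ k) : gaussianRisk μ k ≤ k :=
  ENNReal.toReal_le_of_le_ofReal hk ((gaussianBayes_le μ 1 _).trans (min_le_right _ _))

lemma gaussianRisk_of_nonpos (μ : ℝ) {k : ℝ} (hk : k ≤ 0) : gaussianRisk μ k = 0 := by
  have := gaussianBayes_le μ 1 0
  rw [gaussianRisk, ENNReal.ofReal_of_nonpos hk, le_zero_iff.1 (this.trans (min_le_right _ _)),
    ENNReal.toReal_zero]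

/-- Homogeneity of the Bayes risk combined with `gaussianBayes_comm`. This is the dual form of the
symmetry of a trade-off function, see `IsConjugate.le_comm`. -/
lemma gaussianRisk_inv (μ : ℝ) {k : ℝ} (hk : 0 < k) :
    gaussianRisk μ k = k * gaussianRisk μ k⁻¹ := by
  have h0 : ENNReal.ofReal k ≠ 0 := by simpa using hk
  have h := gaussianBayes_mul μ (ENNReal.ofReal k⁻¹) 1 (ENNReal.ofReal k)
  rw [ENNReal.ofReal_inv_of_pos hk, ENNReal.mul_inv_cancel h0 ENNReal.ofReal_ne_top, mul_one] at h
  rw [gaussianRisk, gaussianRisk, h, ENNReal.toReal_mul,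
    ENNReal.toReal_ofReal hk.le, gaussianBayes_comm, ENNReal.ofReal_inv_of_pos hk]

lemma gaussianRisk_anti {μ ν : ℝ} (hμ : 0 ≤ μ) (h : μ ≤ ν) (k : ℝ) :
    gaussianRisk ν k ≤ gaussianRisk μ k :=
  ENNReal.toReal_mono (gaussianBayes_ne_top μ ENNReal.ofReal_ne_top) (gaussianBayes_anti hμ h _ _)

lemma monotone_gaussianRisk (μ : ℝ) : Monotone (gaussianRisk μ) := fun _ _ h =>
  ENNReal.toReal_mono (gaussianBayes_ne_top μ ENNReal.ofReal_ne_top)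
    (lintegral_mono fun _ => min_le_min_left _ (ENNReal.ofReal_le_ofReal h))

/-- The price is parametrized by the threshold `t` of an optimal test: it is the likelihood ratio at
`t`. -/
lemma gaussianRisk_exp {μ : ℝ} (hμ : 0 ≤ μ) (t : ℝ) :
    gaussianRisk μ (Real.exp (μ * t - μ ^ 2 / 2))
      = stdCdf (t - μ) + Real.exp (μ * t - μ ^ 2 / 2) * (1 - stdCdf t) := by
  have h0 : 0 ≤ 1 - stdCdf t := sub_nonneg.2 (cdf_le_one _ _)
  have h := gaussianBayes_exp hμ t
  rw [gaussianLikelihood, ← ENNReal.ofReal_mul (Real.exp_nonneg _),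
    ← ENNReal.ofReal_add (cdf_nonneg _ _) (mul_nonneg (Real.exp_nonneg _) h0)] at h
  rw [gaussianRisk, h, ENNReal.toReal_ofReal]
  exact add_nonneg (cdf_nonneg _ _) (mul_nonneg (Real.exp_nonneg _) h0)

lemma gaussianRisk_zero {k : ℝ} (hk : 0 ≤ k) : gaussianRisk 0 k = min 1 k := by
  rw [gaussianRisk, gaussianBayes_zero, ENNReal.toReal_min ENNReal.one_ne_top ENNReal.ofReal_ne_top,
    ENNReal.toReal_ofReal hk, ENNReal.toReal_one]

lemma exists_stdCdf_eq {x : ℝ} (h0 : 0 < x) (h1 : x < 1) : ∃ t, stdCdf t = x := by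
  obtain ⟨a, ha⟩ := ((tendsto_cdf_atBot (gaussianReal 0 1)).eventually_lt_const h0).exists
  obtain ⟨b, hb⟩ := ((tendsto_cdf_atTop (gaussianReal 0 1)).eventually_const_lt h1).exists
  exact mem_range_of_exists_le_of_exists_ge continuous_cdf_gaussianReal ⟨a, ha.le⟩ ⟨b, hb.le⟩

/-! ### The Gaussian trade-off function -/

lemma gaussianRisk_le_test (μ : ℝ) {k : ℝ} (hk : 0 ≤ k) {φ : ℝ → ℝ} (hφ : Measurable φ)
    (h01 : ∀ y, φ y ∈ Icc (0 : ℝ) 1) :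
    gaussianRisk μ k ≤ (1 - ∫ y, φ y ∂gaussianReal μ 1) + k * ∫ y, φ y ∂gaussianReal 0 1 := by
  have h1 := one_sub_integral_nonneg (gaussianReal μ 1) h01
  have h2 : 0 ≤ ∫ y, φ y ∂gaussianReal 0 1 := integral_nonneg fun y => (h01 y).1
  refine ENNReal.toReal_le_of_le_ofReal (by positivity) ?_
  have hm : Measurable fun y => ENNReal.ofReal (1 - φ y) := by fun_prop
  have hm' : Measurable fun y => ENNReal.ofReal (φ y) := by fun_prop
  rw [← lintegral_test_eq _ _ hφ h01 hk, lintegral_gaussianReal_eq_likelihood μ hm, one_mul,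
    ← lintegral_const_mul _ hm', ← lintegral_add_right _ (hm'.const_mul _)]
  refine lintegral_mono fun x => ?_
  rw [one_mul]
  exact min_le_test (h01 x) _ _

lemma gaussianRisk_sub_le_gaussianTradeoff (μ : ℝ) {k α : ℝ} (hk : 0 ≤ k) (hα : 0 ≤ α) :
    gaussianRisk μ k - k * α ≤ gaussianTradeoff μ α := by
  refine le_tradeoff _ _ hα fun φ hφ h01 h => ?_
  have := gaussianRisk_le_test μ hk hφ h01
  nlinarith [mul_le_mul_of_nonneg_left h hk]

lemma gaussianTradeoff_le_of_test (μ : ℝ) {α : ℝ} {φ : ℝ → ℝ} (hφ : Measurable φ)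
    (h01 : ∀ y, φ y ∈ Icc (0 : ℝ) 1) (h : ∫ y, φ y ∂gaussianReal 0 1 ≤ α) :
    gaussianTradeoff μ α ≤ 1 - ∫ y, φ y ∂gaussianReal μ 1 :=
  csInf_le (tradeoff_set_bddBelow _ _ _) ⟨φ, hφ, h01, h, rfl⟩

lemma gaussianReal_real_Ioi (μ t : ℝ) : (gaussianReal μ 1).real (Ioi t) = 1 - stdCdf (t - μ) := by
  have h : gaussianReal μ 1 = (gaussianReal 0 1).map (μ + ·) := by
    rw [gaussianReal_map_const_add, zero_add]
  have h2 : (fun x => μ + x) ⁻¹' Ioi t = (Iic (t - μ))ᶜ := by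
    ext x; simp [sub_lt_iff_lt_add']
  rw [h, map_measureReal_apply (measurable_const_add μ) measurableSet_Ioi, h2,
    probReal_compl_eq_one_sub measurableSet_Iic, ← cdf_eq_real]

/-- Neyman–Pearson: the test that rejects beyond `t` gives the upper bound, and the supporting line
whose price is the likelihood ratio at `t` gives the lower bound. -/
lemma gaussianTradeoff_one_sub_stdCdf {μ : ℝ} (hμ : 0 ≤ μ) (t : ℝ) :
    gaussianTradeoff μ (1 - stdCdf t) = stdCdf (t - μ) := by
  refine le_antisymm ?_ ?_
  · have hint : ∀ ν, ∫ y, (Ioi t).indicator 1 y ∂gaussianReal ν 1 = 1 - stdCdf (t - ν) := fun ν => by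
      rw [integral_indicator_one measurableSet_Ioi, gaussianReal_real_Ioi]
    have h := gaussianTradeoff_le_of_test μ (φ := (Ioi t).indicator 1) (α := 1 - stdCdf t)
      (measurable_one.indicator measurableSet_Ioi)
      (fun y => by by_cases hy : y ∈ Ioi t <;> simp [hy]) (by rw [hint, sub_zero])
    rw [hint] at h
    linarith
  · have h := gaussianRisk_sub_le_gaussianTradeoff μ (Real.exp_nonneg (μ * t - μ ^ 2 / 2))
      (sub_nonneg.2 (cdf_le_one (gaussianReal 0 1) t))
    rw [gaussianRisk_exp hμ] at h
    linarith

lemma gaussianTradeoff_one (μ : ℝ) : gaussianTradeoff μ 1 = 0 := by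
  refine le_antisymm ?_ ?_
  · simpa using gaussianTradeoff_le_of_test μ (φ := fun _ => 1) (α := 1) measurable_const
      (fun _ => by simp) (by simp)
  · simpa [gaussianRisk_of_nonpos] using
      gaussianRisk_sub_le_gaussianTradeoff μ (k := 0) (α := 1) le_rfl zero_le_one

lemma gaussianTradeoff_le_one (μ : ℝ) {α : ℝ} (hα : 0 ≤ α) : gaussianTradeoff μ α ≤ 1 := by
  simpa using gaussianTradeoff_le_of_test μ (φ := fun _ => 0) measurable_const
    (fun _ => by simp) (by simpa using hα)

/-- By monotonicity only the supremum matters, and the values at the prices of `gaussianRisk_exp`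
are at least `stdCdf (t - μ)`, which tends to `1`. This avoids letting these prices tend to
infinity, which they do not for `μ = 0`. -/
lemma tendsto_gaussianRisk {μ : ℝ} (hμ : 0 ≤ μ) :
    Filter.Tendsto (gaussianRisk μ) Filter.atTop (nhds 1) := by
  refine tendsto_atTop_isLUB (monotone_gaussianRisk μ)
    ⟨by rintro _ ⟨k, rfl⟩; exact gaussianRisk_le_one μ k, fun b hb => ?_⟩
  have h : Filter.Tendsto (fun t => stdCdf (t - μ)) Filter.atTop (nhds 1) :=
    (tendsto_cdf_atTop _).comp (Filter.tendsto_atTop_add_const_right _ _ Filter.tendsto_id)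
  refine le_of_tendsto h (Filter.Eventually.of_forall fun t => ?_)
  refine le_trans ?_ (hb ⟨Real.exp (μ * t - μ ^ 2 / 2), rfl⟩)
  rw [gaussianRisk_exp hμ]
  nlinarith [Real.exp_nonneg (μ * t - μ ^ 2 / 2), cdf_le_one (gaussianReal 0 1) t]

lemma gaussianTradeoff_zero {μ : ℝ} (hμ : 0 ≤ μ) : gaussianTradeoff μ 0 = 1 := by
  refine le_antisymm (gaussianTradeoff_le_one μ le_rfl) ?_
  refine le_of_tendsto (tendsto_gaussianRisk hμ) ?_
  filter_upwards [Filter.eventually_ge_atTop 0] with k hk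
  simpa using gaussianRisk_sub_le_gaussianTradeoff μ hk le_rfl

/-! ### Suprema of affine functions -/

/-- On `[0,1]`, `f` is the supremum of the affine functions `α ↦ F k - k α`, `k ≥ 0`. -/
def IsConjugate (F f : ℝ → ℝ) : Prop :=
  ∀ α ∈ Icc (0 : ℝ) 1, IsLUB {v | ∃ k, 0 ≤ k ∧ v = F k - k * α} (f α)

namespace IsConjugate

variable {F F' f f' : ℝ → ℝ}

lemma le (h : IsConjugate F f) {α k : ℝ} (hα : α ∈ Icc (0 : ℝ) 1) (hk : 0 ≤ k) :
    F k - k * α ≤ f α := (h α hα).1 ⟨k, hk, rfl⟩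

lemma le_iff (h : IsConjugate F f) {α b : ℝ} (hα : α ∈ Icc (0 : ℝ) 1) :
    f α ≤ b ↔ ∀ k, 0 ≤ k → F k - k * α ≤ b := by
  rw [isLUB_le_iff (h α hα)]
  exact ⟨fun hb k hk => hb ⟨k, hk, rfl⟩, by rintro hb _ ⟨k, hk, rfl⟩; exact hb k hk⟩

/-- Used both for `f^L ≤ f` and for the monotonicity in `g`. -/
lemma mono (h : IsConjugate F f) (h' : IsConjugate F' f') (hF : ∀ k, 0 ≤ k → F k ≤ F' k) {α : ℝ}
    (hα : α ∈ Icc (0 : ℝ) 1) : f α ≤ f' α :=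
  (h.le_iff hα).2 fun k hk => (sub_le_sub_right (hF k hk) _).trans (h'.le hα hk)

/-- A supremum of non-increasing affine functions is convex and non-increasing; the price `0` gives
`f ≥ 0`, and `F k ≤ min 1 k` gives `f α ≤ 1 - α`. Continuity comes from convexity in the interior,
from lower semicontinuity and monotonicity at `0`, and from `0 ≤ f α ≤ 1 - α` at `1`. -/
lemma isTradeoffFunction (h : IsConjugate F f) (h0 : F 0 = 0) (h1 : ∀ k, 0 ≤ k → F k ≤ 1)
    (hk : ∀ k, 0 ≤ k → F k ≤ k) : IsTradeoffFunction f := by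
  have hanti : AntitoneOn f (Icc 0 1) := fun x hx y hy hxy =>
    (h.le_iff hy).2 fun k hk => (by nlinarith [mul_le_mul_of_nonneg_left hxy hk] :
      F k - k * y ≤ F k - k * x).trans (h.le hx hk)
  have hconv : ConvexOn ℝ (Icc 0 1) f := by
    refine ⟨convex_Icc 0 1, fun x hx y hy a b ha hb hab => ?_⟩
    refine (h.le_iff (convex_Icc (0 : ℝ) 1 hx hy ha hb hab)).2 fun k hk => ?_
    have hx' := mul_le_mul_of_nonneg_left (h.le hx hk) ha
    have hy' := mul_le_mul_of_nonneg_left (h.le hy hk) hb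
    have : F k = a * F k + b * F k := by rw [← add_mul, hab, one_mul]
    simp only [smul_eq_mul]
    nlinarith
  have hnonneg : ∀ α ∈ Icc (0 : ℝ) 1, 0 ≤ f α := fun α hα => by
    simpa [h0] using h.le hα (le_refl 0)
  have hle : ∀ α ∈ Icc (0 : ℝ) 1, f α ≤ 1 - α := fun α hα => (h.le_iff hα).2 fun k hk0 => by
    rcases le_total k 1 with hk1 | hk1
    · nlinarith [hk k hk0, hα.1, hα.2]
    · nlinarith [h1 k hk0, hα.1, hα.2]
  refine ⟨hconv, ?_, hanti, hnonneg, hle⟩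
  intro x hx
  rcases hx.1.eq_or_lt with rfl | hx0
  · rw [ContinuousWithinAt, tendsto_order]
    refine ⟨fun b hb => ?_, fun b hb => ?_⟩
    · obtain ⟨_, ⟨k, hk0, rfl⟩, hbk⟩ := (lt_isLUB_iff (h 0 hx)).1 hb
      have hc : ContinuousWithinAt (fun α => F k - k * α) (Icc 0 1) 0 := by fun_prop
      filter_upwards [hc.tendsto.eventually_const_lt hbk, self_mem_nhdsWithin] with α hα hα'
      exact hα.trans_le (h.le hα' hk0)
    · filter_upwards [self_mem_nhdsWithin] with α hα
      exact (hanti hx hα hα.1).trans_lt hb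
  rcases hx.2.eq_or_lt with rfl | hx1
  · have hf1 : f 1 = 0 := le_antisymm (by simpa using hle 1 hx) (hnonneg 1 hx)
    rw [ContinuousWithinAt, hf1]
    have hc : Filter.Tendsto (fun α : ℝ => 1 - α) (nhdsWithin 1 (Icc 0 1)) (nhds 0) := by
      have : ContinuousWithinAt (fun α : ℝ => 1 - α) (Icc 0 1) 1 := by fun_prop
      simpa [ContinuousWithinAt] using this
    refine tendsto_of_tendsto_of_tendsto_of_le_of_le' tendsto_const_nhds hc ?_ ?_
    · filter_upwards [self_mem_nhdsWithin] with α hα using hnonneg α hα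
    · filter_upwards [self_mem_nhdsWithin] with α hα using hle α hα
  · have hint : x ∈ interior (Icc (0 : ℝ) 1) := by rw [interior_Icc]; exact ⟨hx0, hx1⟩
    exact (hconv.continuousOn_interior.continuousAt
      (isOpen_interior.mem_nhds hint)).continuousWithinAt

/-- The condition `f x ≤ y` says `F k ≤ k x + y` for all prices. Multiplying its instance at `k⁻¹`
by `k` exchanges `x` and `y`. -/
lemma le_comm (h : IsConjugate F f) (h0 : F 0 = 0) (hinv : ∀ k, 0 < k → F k = k * F k⁻¹)
    {x y : ℝ} (hx : x ∈ Icc (0 : ℝ) 1) (hy : y ∈ Icc (0 : ℝ) 1) (hxy : f x ≤ y) : f y ≤ x := by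
  refine (h.le_iff hy).2 fun k hk => ?_
  rcases hk.eq_or_lt with rfl | hk
  · simpa [h0] using hx.1
  · have hb := mul_le_mul_of_nonneg_left ((h.le_iff hx).1 hxy k⁻¹ (inv_nonneg.2 hk.le)) hk.le
    rw [mul_sub, ← hinv k hk, mul_inv_cancel_left₀ hk.ne'] at hb
    linarith

lemma isSymmetricTradeoffFunction (h : IsConjugate F f) (h0 : F 0 = 0)
    (h1 : ∀ k, 0 ≤ k → F k ≤ 1) (hk : ∀ k, 0 ≤ k → F k ≤ k)
    (hinv : ∀ k, 0 < k → F k = k * F k⁻¹) : IsSymmetricTradeoffFunction f := by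
  have ht := h.isTradeoffFunction h0 h1 hk
  refine ⟨ht, fun α hα => ?_⟩
  have hf : f α ∈ Icc (0 : ℝ) 1 := ⟨ht.nonneg α hα, (ht.le_one_sub α hα).trans (by linarith [hα.1])⟩
  refine IsLeast.csInf_eq ⟨⟨hf, h.le_comm h0 hinv hα hf le_rfl⟩, fun t ht => ?_⟩
  exact h.le_comm h0 hinv ht.1 hα ht.2

end IsConjugate

/-- For `0 < α < 1` the supremum is attained at the likelihood ratio of the threshold; `α = 1` needs
the price `0`, and `α = 0` the limit of infinite price. -/
lemma isConjugate_gaussianTradeoff {μ : ℝ} (hμ : 0 ≤ μ) :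
    IsConjugate (gaussianRisk μ) (gaussianTradeoff μ) := by
  intro α hα
  refine ⟨?_, fun b hb => ?_⟩
  · rintro _ ⟨k, hk, rfl⟩
    exact gaussianRisk_sub_le_gaussianTradeoff μ hk hα.1
  rcases hα.1.eq_or_lt with rfl | h0
  · rw [gaussianTradeoff_zero hμ]
    refine le_of_tendsto (tendsto_gaussianRisk hμ) ?_
    filter_upwards [Filter.eventually_ge_atTop 0] with k hk
    simpa using hb ⟨k, hk, rfl⟩
  rcases hα.2.eq_or_lt with rfl | h1
  · rw [gaussianTradeoff_one]
    simpa [gaussianRisk_of_nonpos] using hb ⟨0, le_rfl, rfl⟩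
  · obtain ⟨t, ht⟩ := exists_stdCdf_eq (x := 1 - α) (by linarith) (by linarith)
    obtain rfl : α = 1 - stdCdf t := by linarith
    rw [gaussianTradeoff_one_sub_stdCdf hμ]
    have := hb ⟨_, Real.exp_nonneg (μ * t - μ ^ 2 / 2), rfl⟩
    rw [gaussianRisk_exp hμ] at this
    linarith

lemma isSymmetricTradeoffFunction_gaussianTradeoff {μ : ℝ} (hμ : 0 ≤ μ) :
    IsSymmetricTradeoffFunction (gaussianTradeoff μ) :=
  (isConjugate_gaussianTradeoff hμ).isSymmetricTradeoffFunction (gaussianRisk_of_nonpos μ le_rfl)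
    (fun k _ => gaussianRisk_le_one μ k) (fun _ hk => gaussianRisk_le μ hk)
    (fun _ hk => gaussianRisk_inv μ hk)

lemma gaussianTradeoff_zero_left {α : ℝ} (hα : α ∈ Icc (0 : ℝ) 1) :
    gaussianTradeoff 0 α = 1 - α := by
  refine le_antisymm
    ((isSymmetricTradeoffFunction_gaussianTradeoff le_rfl).le_one_sub α hα) ?_
  simpa [gaussianRisk_zero] using gaussianRisk_sub_le_gaussianTradeoff 0 zero_le_one hα.1

/-! ### The lower bounds -/

/-- The function whose conjugate is the lower bound `f^L`. -/
def lowerRisk (μ l k : ℝ) : ℝ := max 0 (gaussianRisk μ k - l * min 1 k)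

lemma gaussianRisk_le_min (μ : ℝ) {k : ℝ} (hk : 0 ≤ k) : gaussianRisk μ k ≤ min 1 k :=
  le_min (gaussianRisk_le_one μ k) (gaussianRisk_le μ hk)

lemma IsTradeoffFunction.mapsTo {f : ℝ → ℝ} (hf : IsTradeoffFunction f) {α : ℝ}
    (hα : α ∈ Icc (0 : ℝ) 1) : f α ∈ Icc (0 : ℝ) 1 :=
  ⟨hf.nonneg α hα, (hf.le_one_sub α hα).trans (by linarith [hα.1])⟩

lemma gaussianTradeoff_le_comm {μ : ℝ} (hμ : 0 ≤ μ) {x y : ℝ} (hx : x ∈ Icc (0 : ℝ) 1)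
    (hy : y ∈ Icc (0 : ℝ) 1) (h : gaussianTradeoff μ x ≤ y) : gaussianTradeoff μ y ≤ x :=
  (isConjugate_gaussianTradeoff hμ).le_comm (gaussianRisk_of_nonpos μ le_rfl)
    (fun _ hk => gaussianRisk_inv μ hk) hx hy h

lemma min_one_add_mem {α l : ℝ} (hα : 0 ≤ α) (hl : 0 ≤ l) : min 1 (α + l) ∈ Icc (0 : ℝ) 1 :=
  ⟨le_min zero_le_one (add_nonneg hα hl), min_le_left _ _⟩

/-- By symmetry of `G`, the condition `G (min 1 (t + l)) ≤ α` is the same as `G α ≤ t + l`, whose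
least solution `t ≥ 0` can be read off. -/
lemma tradeoffInv_lowerHat {σ c l α : ℝ} (hμ : 0 ≤ c / σ) (hl : 0 ≤ l) (hα : α ∈ Icc (0 : ℝ) 1) :
    tradeoffInv (lowerHat σ c l) α = max 0 (gaussianTradeoff (c / σ) α - l) := by
  have hG := (isSymmetricTradeoffFunction_gaussianTradeoff hμ).toIsTradeoffFunction
  have hGα := IsTradeoffFunction.mapsTo hG hα
  have key : ∀ t ∈ Icc (0 : ℝ) 1, lowerHat σ c l t ≤ α ↔ gaussianTradeoff (c / σ) α ≤ t + l := by
    intro t ht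
    have hm := min_one_add_mem ht.1 hl
    refine ⟨fun h => (gaussianTradeoff_le_comm hμ hm hα h).trans (min_le_right _ _), fun h => ?_⟩
    exact gaussianTradeoff_le_comm hμ hα hm (le_min hGα.2 h)
  refine IsLeast.csInf_eq ⟨?_, fun t ht => ?_⟩
  · have hmem : max 0 (gaussianTradeoff (c / σ) α - l) ∈ Icc (0 : ℝ) 1 :=
      ⟨le_max_left _ _, max_le zero_le_one (by linarith [hGα.2])⟩
    exact ⟨hmem, (key _ hmem).2 (by linarith [le_max_right 0 (gaussianTradeoff (c / σ) α - l)])⟩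
  · exact max_le ht.1.1 (by linarith [(key t ht.1).1 ht.2])

lemma lowerBound_eq {σ c l α : ℝ} (hμ : 0 ≤ c / σ) (hl : 0 ≤ l) (hα : α ∈ Icc (0 : ℝ) 1) :
    lowerBound σ c l α
      = max (gaussianTradeoff (c / σ) (min 1 (α + l))) (gaussianTradeoff (c / σ) α - l) := by
  have hG := (isSymmetricTradeoffFunction_gaussianTradeoff hμ).toIsTradeoffFunction
  rw [lowerBound, tradeoffInv_lowerHat hμ hl hα, lowerHat, ← max_assoc,
    max_eq_left (hG.nonneg _ (min_one_add_mem hα.1 hl))]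

/-- Subtracting `l` from the risk lowers `G` by `l`, while subtracting `l k` shifts its argument by
`l`. Subtracting `l min(1,k)` therefore yields the larger of the two functions; the maximum with `0`
accounts for the truncation of `α + l` at `1`. -/
lemma isConjugate_lowerBound {σ c l : ℝ} (hμ : 0 ≤ c / σ) (hl : 0 ≤ l) :
    IsConjugate (lowerRisk (c / σ) l) (lowerBound σ c l) := by
  have hG := (isSymmetricTradeoffFunction_gaussianTradeoff hμ).toIsTradeoffFunction
  have hconj := isConjugate_gaussianTradeoff hμ
  intro α hα
  have hm := min_one_add_mem hα.1 hl
  rw [lowerBound_eq hμ hl hα]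
  refine ⟨?_, fun b hb => ?_⟩
  · rintro _ ⟨k, hk, rfl⟩
    rw [sub_le_iff_le_add, lowerRisk]
    refine max_le (add_nonneg ((hG.nonneg _ hm).trans (le_max_left _ _)) (mul_nonneg hk hα.1)) ?_
    rcases le_total 1 k with h1 | h1
    · rw [min_eq_left h1]
      linarith [hconj.le hα hk, le_max_right (gaussianTradeoff (c / σ) (min 1 (α + l)))
        (gaussianTradeoff (c / σ) α - l)]
    · rw [min_eq_right h1]
      have h2 : gaussianRisk (c / σ) k - k * (α + l) ≤ gaussianTradeoff (c / σ) (min 1 (α + l)) := by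
        have := hconj.le hm hk
        nlinarith [mul_le_mul_of_nonneg_left (min_le_right 1 (α + l)) hk]
      linarith [le_max_left (gaussianTradeoff (c / σ) (min 1 (α + l)))
        (gaussianTradeoff (c / σ) α - l)]
  · have hb' : ∀ k, 0 ≤ k → gaussianRisk (c / σ) k - l * min 1 k - k * α ≤ b := fun k hk =>
      (sub_le_sub_right (le_max_right _ _) _).trans (hb ⟨k, hk, rfl⟩)
    have hb0 : 0 ≤ b := by
      have h : lowerRisk (c / σ) l 0 - 0 * α ≤ b := hb ⟨0, le_rfl, rfl⟩
      rw [zero_mul, sub_zero] at h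
      exact (le_max_left _ _).trans h
    refine max_le ((hconj.le_iff hm).2 fun k hk => ?_) ?_
    · rcases le_total 1 (α + l) with h1 | h1
      · rw [min_eq_left h1]
        linarith [gaussianRisk_le (c / σ) hk]
      · rw [min_eq_right h1]
        nlinarith [hb' k hk, mul_le_mul_of_nonneg_left (min_le_right 1 k) hl]
    · rw [sub_le_iff_le_add]
      refine (hconj.le_iff hα).2 fun k hk => ?_
      nlinarith [hb' k hk, mul_le_mul_of_nonneg_left (min_le_left 1 k) hl]

lemma isSymmetricTradeoffFunction_lowerBound {σ c l : ℝ} (hμ : 0 ≤ c / σ) (hl : 0 ≤ l) :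
    IsSymmetricTradeoffFunction (lowerBound σ c l) := by
  have hmin : ∀ k : ℝ, 0 ≤ k → lowerRisk (c / σ) l k ≤ min 1 k := fun k hk => by
    have h0 : 0 ≤ min 1 k := le_min zero_le_one hk
    exact max_le h0 (by nlinarith [gaussianRisk_le_min (c / σ) hk])
  refine (isConjugate_lowerBound hμ hl).isSymmetricTradeoffFunction ?_
    (fun k hk => (hmin k hk).trans (min_le_left _ _))
    (fun k hk => (hmin k hk).trans (min_le_right _ _)) fun k hk => ?_
  · simp [lowerRisk, gaussianRisk_of_nonpos]
  · have h1 : min 1 k = k * min 1 k⁻¹ := by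
      rw [mul_min_of_nonneg _ _ hk.le, mul_inv_cancel₀ hk.ne', mul_one, min_comm]
    rw [lowerRisk, lowerRisk, mul_max_of_nonneg _ _ hk.le, mul_zero, gaussianRisk_inv _ hk, h1]
    congr 1
    ring

/-- A chord of a convex function of fixed length becomes less steep to the right. -/
lemma ConvexOn.add_le_add_of_shift {s : Set ℝ} {G : ℝ → ℝ} (hG : ConvexOn ℝ s G) {x y l : ℝ}
    (hxy : x ≤ y) (hl : 0 ≤ l) (hx : x ∈ s) (hy : y + l ∈ s) :
    G y + G (x + l) ≤ G x + G (y + l) := by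
  rcases (by linarith : 0 ≤ y + l - x).eq_or_lt with h0 | h0
  · obtain rfl : y = x := by linarith
    obtain rfl : l = 0 := by linarith
    simp
  -- With this weight `y` and `x + l` are mirror-image convex combinations of `x` and `y + l`, so
  -- the two convexity inequalities add up to the claim.
  set w := (y - x) / (y + l - x)
  have hw : w * (y + l - x) = y - x := div_mul_cancel₀ _ h0.ne'
  have hw0 : 0 ≤ w := div_nonneg (by linarith) h0.le
  have hw1 : w ≤ 1 := (div_le_one h0).2 (by linarith)
  have h1 := hG.2 hx hy (sub_nonneg.2 hw1) hw0 (by ring)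
  have h2 := hG.2 hx hy hw0 (sub_nonneg.2 hw1) (by ring)
  simp only [smul_eq_mul] at h1 h2
  rw [show (1 - w) * x + w * (y + l) = y by linarith] at h1
  rw [show w * x + (1 - w) * (y + l) = x + l by linarith] at h2
  linarith

/-- The point at which the two branches of `f^L` meet. -/
lemma exists_crossover {σ c l : ℝ} (hμ : 0 ≤ c / σ) (hl : 0 ≤ l) (hl1 : l ≤ 1) :
    ∃ β ∈ Icc (0 : ℝ) 1,
      (∀ x ∈ Icc (0 : ℝ) 1, gaussianTradeoff (c / σ) x - l = x ↔ x = β) ∧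
      (∀ α ∈ Icc 0 β, lowerBound σ c l α = gaussianTradeoff (c / σ) α - l) ∧
      (∀ α ∈ Icc β 1, lowerBound σ c l α = gaussianTradeoff (c / σ) (min 1 (α + l))) := by
  have hG := (isSymmetricTradeoffFunction_gaussianTradeoff hμ).toIsTradeoffFunction
  have hG0 : gaussianTradeoff (c / σ) 0 = 1 := gaussianTradeoff_zero hμ
  have hG1 : gaussianTradeoff (c / σ) 1 = 0 := gaussianTradeoff_one _
  set G := gaussianTradeoff (c / σ)
  have h0 : (0 : ℝ) ∈ Icc (0 : ℝ) 1 := by simp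
  have h1 : (1 : ℝ) ∈ Icc (0 : ℝ) 1 := by simp
  obtain ⟨β, hβ, hβe⟩ : l ∈ (fun x => G x - x) '' Icc 0 1 :=
    intermediate_value_Icc' zero_le_one (hG.continuousOn.sub continuousOn_id)
      ⟨by simp [hG1]; linarith, by simpa [hG0] using hl1⟩
  have hβe : G β = β + l := by simp only at hβe; linarith
  have hβl : β + l ∈ Icc (0 : ℝ) 1 := hβe ▸ IsTradeoffFunction.mapsTo hG hβ
  have hlow : G (β + l) ≤ β := gaussianTradeoff_le_comm hμ hβ hβl hβe.le
  -- If `t = G (β + l)` were below `β`, symmetry would give `G t ≤ β + l = G β`. But a convex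
  -- function with `G 1 = 0` decreases strictly as long as it is positive, and `G β > 0`.
  have hup : β ≤ G (β + l) := by
    by_contra! hlt
    set t := G (β + l)
    have ht : t ∈ Icc (0 : ℝ) 1 := IsTradeoffFunction.mapsTo hG hβl
    have htβ : G t ≤ G β := hβe ▸ gaussianTradeoff_le_comm hμ hβl ht le_rfl
    have hβ1 : 0 < 1 - t := by linarith [hβ.2]
    set w := (β - t) / (1 - t)
    have hw : w * (1 - t) = β - t := div_mul_cancel₀ _ hβ1.ne'
    have hw0 : 0 < w := div_pos (by linarith) hβ1
    have hw1 : w ≤ 1 := (div_le_one hβ1).2 (by linarith [hβ.2])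
    have h := hG.convexOn.2 ht h1 (sub_nonneg.2 hw1) hw0.le (by ring)
    simp only [smul_eq_mul] at h
    rw [show (1 - w) * t + w * 1 = β by linarith, hG1] at h
    have hpos : 0 < G β := by rw [hβe]; linarith [ht.1]
    nlinarith [mul_le_mul_of_nonneg_left htβ (sub_nonneg.2 hw1), mul_pos hw0 hpos]
  refine ⟨β, hβ, fun x hx => ⟨fun h => ?_, fun h => by rw [h, hβe]; ring⟩, fun α hα => ?_,
    fun α hα => ?_⟩
  · rcases le_total x β with h' | h'
    · linarith [hG.antitoneOn hx hβ h']
    · linarith [hG.antitoneOn hβ hx h']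
  · have hα' : α ∈ Icc (0 : ℝ) 1 := ⟨hα.1, hα.2.trans hβ.2⟩
    rw [lowerBound_eq hμ hl hα']
    refine max_eq_right ?_
    rw [min_eq_right (by linarith [hα.2, hβl.2])]
    -- Both branches agree at `β`, since `G β - l = β = G (β + l)`; comparing the chords of length
    -- `l` at `α` and at `β` decides which branch is larger.
    have := hG.convexOn.add_le_add_of_shift hα.2 hl hα' hβl
    linarith
  · have hα' : α ∈ Icc (0 : ℝ) 1 := ⟨hβ.1.trans hα.1, hα.2⟩
    rw [lowerBound_eq hμ hl hα']
    refine max_eq_left (show G α - l ≤ G (min 1 (α + l)) from ?_)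
    rcases le_total 1 (α + l) with h | h
    · rw [min_eq_left h, hG1]
      linarith [hG.le_one_sub α hα']
    · rw [min_eq_right h]
      have := hG.convexOn.add_le_add_of_shift hα.1 hl hβ ⟨by linarith [hα'.1], h⟩
      linarith

/-! ### Mixtures -/

/-- The weights `q` on `𝒞` are the distribution of a nonnegative random variable `c` on a finite
probability space with weights `p`. -/
structure HasFiniteLaw {ι : Type*} [Fintype ι] (𝒞 : Set ℝ) (q : ℝ → ℝ) (p : ι → ℝ) (c : ι → 𝒞) :
    Prop where
  nonneg : ∀ i, 0 ≤ p i
  sum_eq : ∑ i, p i = 1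
  value_nonneg : ∀ i, 0 ≤ (c i : ℝ)
  tsum_eq : ∀ F : 𝒞 → ℝ, ∑' x : 𝒞, q x * F x = ∑ i, p i * F (c i)

/-- The Bayes risk of a mixture of Gaussian testing problems. -/
def mixtureRisk {ι : Type*} [Fintype ι] (p c : ι → ℝ) (σ k : ℝ) : ℝ :=
  ∑ i, p i * gaussianRisk (c i / σ) k

/-- `θ` is an admissible value of `Φ(Λ σ / c)` at `c = 0`. -/
structure IsBoundaryValue (Λ : EReal) (θ : ℝ) : Prop where
  mem : θ ∈ Icc (0 : ℝ) 1
  eq_one : 0 < Λ → θ = 1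
  eq_zero : Λ < 0 → θ = 0

lemma IsThreshold.isBoundaryValue {𝒞 : Set ℝ} {q : ℝ → ℝ} {σ α θ : ℝ} {Λ : EReal}
    (h : IsThreshold 𝒞 q σ α Λ θ) : IsBoundaryValue Λ θ := ⟨h.mem, h.eq_one, h.eq_zero⟩

lemma shiftedCdf_coe {σ Λ θ ε c : ℝ} (hc : c ≠ 0) :
    shiftedCdf σ Λ θ ε c = stdCdf (Λ * (σ / c) + ε * (c / (2 * σ))) := by
  rw [shiftedCdf, if_neg hc, ← EReal.coe_mul, ← EReal.coe_add, stdNormalCdf_coe]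

lemma shiftedCdf_top {σ θ ε c : ℝ} (hσ : 0 < σ) (hc : 0 < c) : shiftedCdf σ ⊤ θ ε c = 1 := by
  rw [shiftedCdf, if_neg hc.ne', EReal.top_mul_coe_of_pos (div_pos hσ hc), EReal.top_add_coe,
    stdNormalCdf_top]

lemma shiftedCdf_bot {σ θ ε c : ℝ} (hσ : 0 < σ) (hc : 0 < c) : shiftedCdf σ ⊥ θ ε c = 0 := by
  rw [shiftedCdf, if_neg hc.ne', EReal.bot_mul_coe_of_pos (div_pos hσ hc), EReal.bot_add,
    stdNormalCdf_bot]

lemma shiftedCdf_mem {σ θ ε c : ℝ} {Λ : EReal} (hθ : θ ∈ Icc (0 : ℝ) 1) :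
    shiftedCdf σ Λ θ ε c ∈ Icc (0 : ℝ) 1 := by
  rw [shiftedCdf]
  split_ifs
  exacts [hθ, stdNormalCdf_mem_Icc _]

/-- For `c > 0` and finite `Λ` this is `gaussianTradeoff_one_sub_stdCdf` at `t = Λ σ / c + c / (2
σ)`. For `c = 0` it is `G_0(1 - θ) = θ`, which holds for every randomization `θ`. -/
lemma gaussianTradeoff_one_sub_shiftedCdf {σ θ c : ℝ} {Λ : EReal} (hσ : 0 < σ) (hc : 0 ≤ c)
    (hθ : IsBoundaryValue Λ θ) :
    gaussianTradeoff (c / σ) (1 - shiftedCdf σ Λ θ 1 c) = shiftedCdf σ Λ θ (-1) c := by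
  rcases hc.eq_or_lt with rfl | hc
  · have h1 : 1 - θ ∈ Icc (0 : ℝ) 1 := ⟨by linarith [hθ.mem.2], by linarith [hθ.mem.1]⟩
    simp only [shiftedCdf, if_true, zero_div]
    rw [gaussianTradeoff_zero_left h1, sub_sub_cancel]
  have hμ : 0 ≤ c / σ := (div_pos hc hσ).le
  induction Λ with
  | top => rw [shiftedCdf_top hσ hc, shiftedCdf_top hσ hc, sub_self, gaussianTradeoff_zero hμ]
  | bot => rw [shiftedCdf_bot hσ hc, shiftedCdf_bot hσ hc, sub_zero, gaussianTradeoff_one]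
  | coe Λ =>
    rw [shiftedCdf_coe hc.ne', shiftedCdf_coe hc.ne', gaussianTradeoff_one_sub_stdCdf hμ]
    congr 1
    field_simp
    ring

/-- At the threshold `Λ σ / c + c / (2 σ)` the log-likelihood ratio for the separation `c / σ`
equals `Λ`, whatever `c` is. So one price `exp Λ` is optimal for all components at once. For `c = 0`
the risk is `min 1 (exp Λ)`, which explains the rules for `θ`. -/
lemma gaussianRisk_exp_eq {σ θ c Λ : ℝ} (hσ : 0 < σ) (hc : 0 ≤ c) (hθ : IsBoundaryValue Λ θ) :
    gaussianRisk (c / σ) (Real.exp Λ)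
      = shiftedCdf σ Λ θ (-1) c + Real.exp Λ * (1 - shiftedCdf σ Λ θ 1 c) := by
  rcases hc.eq_or_lt with rfl | hc
  · simp only [shiftedCdf, if_true, zero_div]
    rw [gaussianRisk_zero (Real.exp_nonneg _)]
    rcases lt_trichotomy Λ 0 with h | rfl | h
    · rw [hθ.eq_zero (by exact_mod_cast h), min_eq_right (Real.exp_le_one_iff.2 h.le)]; ring
    · simp
    · rw [hθ.eq_one (by exact_mod_cast h), min_eq_left (Real.one_le_exp_iff.2 h.le)]; ring
  · have h := gaussianRisk_exp (div_pos hc hσ).le (Λ * (σ / c) + 1 * (c / (2 * σ)))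
    have h1 : c / σ * (Λ * (σ / c) + 1 * (c / (2 * σ))) - (c / σ) ^ 2 / 2 = Λ := by
      field_simp; ring
    have h2 : Λ * (σ / c) + 1 * (c / (2 * σ)) - c / σ = Λ * (σ / c) + -1 * (c / (2 * σ)) := by
      field_simp; ring
    rw [h1, h2] at h
    rw [shiftedCdf_coe hc.ne', shiftedCdf_coe hc.ne', h]

namespace HasFiniteLaw

variable {ι : Type*} [Fintype ι] {𝒞 : Set ℝ} {q : ℝ → ℝ} {p : ι → ℝ} {c : ι → 𝒞} {σ α θ : ℝ}
  {Λ : EReal}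

lemma mixtureRisk_sub_le (h : HasFiniteLaw 𝒞 q p c) {a : 𝒞 → ℝ} (ha : ∀ x, a x ∈ Icc (0 : ℝ) 1)
    (hsum : ∑' x : 𝒞, q x * a x = α) {k : ℝ} (hk : 0 ≤ k) :
    mixtureRisk p (fun i => c i) σ k - k * α
      ≤ ∑' x : 𝒞, q x * gaussianTradeoff (x / σ) (a x) := by
  rw [h.tsum_eq] at hsum
  rw [h.tsum_eq fun x => gaussianTradeoff (x / σ) (a x), mixtureRisk, ← hsum, Finset.mul_sum,
    ← Finset.sum_sub_distrib]
  refine Finset.sum_le_sum fun i _ => ?_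
  have := mul_le_mul_of_nonneg_left
    (gaussianRisk_sub_le_gaussianTradeoff ((c i : ℝ) / σ) hk (ha (c i)).1) (h.nonneg i)
  linarith

lemma tsum_one_sub_shiftedCdf (h : HasFiniteLaw 𝒞 q p c) (hΛ : IsThreshold 𝒞 q σ α Λ θ) :
    ∑' x : 𝒞, q x * (1 - shiftedCdf σ Λ θ 1 x) = α := by
  have h1 := hΛ.eq
  rw [h.tsum_eq fun x => shiftedCdf σ Λ θ 1 x] at h1
  rw [h.tsum_eq fun x => 1 - shiftedCdf σ Λ θ 1 x]
  simp only [mul_sub, mul_one, Finset.sum_sub_distrib, h.sum_eq]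
  linarith

lemma thresholdValue_eq (h : HasFiniteLaw 𝒞 q p c) (hσ : 0 < σ) (hθ : IsBoundaryValue Λ θ) :
    thresholdValue 𝒞 q σ Λ θ
      = ∑' x : 𝒞, q x * gaussianTradeoff (x / σ) (1 - shiftedCdf σ Λ θ 1 x) := by
  rw [thresholdValue, h.tsum_eq fun x => shiftedCdf σ Λ θ (-1) x,
    h.tsum_eq fun x => gaussianTradeoff (x / σ) (1 - shiftedCdf σ Λ θ 1 x)]
  exact Finset.sum_congr rfl fun i _ => by
    rw [gaussianTradeoff_one_sub_shiftedCdf hσ (h.value_nonneg i) hθ]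

lemma one_sub_shiftedCdf_mem (hθ : IsBoundaryValue Λ θ) (x : ℝ) :
    1 - shiftedCdf σ Λ θ 1 x ∈ Icc (0 : ℝ) 1 := by
  have := shiftedCdf_mem (σ := σ) (ε := 1) (c := x) (Λ := Λ) hθ.mem
  exact ⟨by linarith [this.2], by linarith [this.1]⟩

lemma sum_shiftedCdf_top (h : HasFiniteLaw 𝒞 q p c) (hσ : 0 < σ) (ε : ℝ) :
    ∑ i, p i * shiftedCdf σ ⊤ 1 ε (c i) = 1 := by
  refine Eq.trans (Finset.sum_congr rfl fun i _ => ?_) h.sum_eq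
  rcases (h.value_nonneg i).eq_or_lt with h0 | h0
  · rw [← h0, shiftedCdf, if_pos rfl, mul_one]
  · rw [shiftedCdf_top hσ h0, mul_one]

lemma sum_shiftedCdf_bot (h : HasFiniteLaw 𝒞 q p c) (hσ : 0 < σ) (ε : ℝ) :
    ∑ i, p i * shiftedCdf σ ⊥ 0 ε (c i) = 0 := by
  refine Finset.sum_eq_zero fun i _ => ?_
  rcases (h.value_nonneg i).eq_or_lt with h0 | h0
  · rw [← h0, shiftedCdf, if_pos rfl, mul_zero]
  · rw [shiftedCdf_bot hσ h0, mul_zero]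

/-- Weak duality gives the upper bound. It is attained at the price `exp Λ` for finite `Λ` and at
the price `0` for `Λ = ⊥`, and approached as the price tends to infinity for `Λ = ⊤`. The supremum
does not involve `Λ`, hence neither does the value. -/
lemma isLUB_thresholdValue (h : HasFiniteLaw 𝒞 q p c) (hσ : 0 < σ)
    (hΛ : IsThreshold 𝒞 q σ α Λ θ) :
    IsLUB {v | ∃ k, 0 ≤ k ∧ v = mixtureRisk p (fun i => c i) σ k - k * α}
      (thresholdValue 𝒞 q σ Λ θ) := by
  have hθ := hΛ.isBoundaryValue
  refine ⟨?_, fun b hb => ?_⟩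
  · rintro _ ⟨k, hk, rfl⟩
    rw [h.thresholdValue_eq hσ hθ]
    exact h.mixtureRisk_sub_le (fun x => one_sub_shiftedCdf_mem hθ x)
      (h.tsum_one_sub_shiftedCdf hΛ) hk
  have heq := hΛ.eq
  rw [h.tsum_eq fun x => shiftedCdf σ Λ θ 1 x] at heq
  rw [thresholdValue, h.tsum_eq fun x => shiftedCdf σ Λ θ (-1) x]
  induction Λ with
  | top =>
    obtain rfl := hθ.eq_one EReal.zero_lt_top
    rw [h.sum_shiftedCdf_top hσ] at heq ⊢
    obtain rfl : α = 0 := by linarith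
    have hlim : Filter.Tendsto (mixtureRisk p (fun i => (c i : ℝ)) σ) Filter.atTop (nhds 1) := by
      have := tendsto_finsetSum (Finset.univ : Finset ι) fun i _ =>
        (tendsto_gaussianRisk (div_nonneg (h.value_nonneg i) hσ.le)).const_mul (p i)
      simp only [mul_one, h.sum_eq] at this
      exact this
    refine le_of_tendsto hlim ?_
    filter_upwards [Filter.eventually_ge_atTop 0] with k hk
    exact hb ⟨k, hk, by simp⟩
  | bot =>
    obtain rfl := hθ.eq_zero EReal.bot_lt_zero
    rw [h.sum_shiftedCdf_bot hσ]
    exact hb ⟨0, le_rfl, by simp [mixtureRisk, gaussianRisk_of_nonpos]⟩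
  | coe Λ =>
    refine (le_of_eq ?_).trans (hb ⟨Real.exp Λ, Real.exp_nonneg _, rfl⟩)
    have hα : α = ∑ i, p i * (1 - shiftedCdf σ Λ θ 1 (c i)) := by
      simp only [mul_sub, mul_one, Finset.sum_sub_distrib, h.sum_eq]
      linarith
    rw [hα, mixtureRisk, Finset.mul_sum, ← Finset.sum_sub_distrib]
    refine Finset.sum_congr rfl fun i _ => ?_
    rw [gaussianRisk_exp_eq hσ (h.value_nonneg i) hθ]
    ring

lemma isGLB_thresholdValue (h : HasFiniteLaw 𝒞 q p c) (hσ : 0 < σ)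
    (hΛ : IsThreshold 𝒞 q σ α Λ θ) :
    IsGLB {v : ℝ | ∃ a : 𝒞 → ℝ, (∀ x, a x ∈ Icc (0 : ℝ) 1) ∧ ∑' x : 𝒞, q x * a x = α ∧
      v = ∑' x : 𝒞, q x * gaussianTradeoff (x / σ) (a x)} (thresholdValue 𝒞 q σ Λ θ) := by
  have hθ := hΛ.isBoundaryValue
  refine ⟨?_, fun b hb => ?_⟩
  · rintro _ ⟨a, ha, hsum, rfl⟩
    refine (isLUB_le_iff (h.isLUB_thresholdValue hσ hΛ)).2 ?_
    rintro _ ⟨k, hk, rfl⟩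
    exact h.mixtureRisk_sub_le ha hsum hk
  · exact hb ⟨fun x => 1 - shiftedCdf σ Λ θ 1 x, fun x => one_sub_shiftedCdf_mem hθ x,
      h.tsum_one_sub_shiftedCdf hΛ, h.thresholdValue_eq hσ hθ⟩

/-- The implicit equation that defines `Λ(α)` has a solution. -/
lemma exists_isThreshold (h : HasFiniteLaw 𝒞 q p c) (hσ : 0 < σ) (hα : α ∈ Icc (0 : ℝ) 1) :
    ∃ Λ θ, IsThreshold 𝒞 q σ α Λ θ := by
  have htsum : ∀ Λ θ, ∑' x : 𝒞, q x * shiftedCdf σ Λ θ 1 x = ∑ i, p i * shiftedCdf σ Λ θ 1 (c i) :=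
    fun Λ θ => h.tsum_eq fun x => shiftedCdf σ Λ θ 1 x
  rcases hα.1.eq_or_lt with rfl | h0
  · exact ⟨⊤, 1, by simp, fun _ => rfl, by simp, by rw [htsum, h.sum_shiftedCdf_top hσ, sub_zero]⟩
  rcases hα.2.eq_or_lt with rfl | h1
  · exact ⟨⊥, 0, by simp, by simp, fun _ => rfl, by rw [htsum, h.sum_shiftedCdf_bot hσ, sub_self]⟩
  have hcont : ∀ θ, Continuous fun Λ : ℝ => ∑ i, p i * shiftedCdf σ Λ θ 1 (c i) := fun θ => by
    refine continuous_finsetSum _ fun i _ => continuous_const.mul ?_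
    by_cases hc : (c i : ℝ) = 0
    · simp only [shiftedCdf, hc, if_true]; exact continuous_const
    · simp only [shiftedCdf_coe hc]
      exact continuous_cdf_gaussianReal.comp (by fun_prop)
  have htop : Filter.Tendsto (fun Λ : ℝ => ∑ i, p i * shiftedCdf σ Λ 1 1 (c i)) Filter.atTop
      (nhds 1) := by
    have hsum : nhds (1 : ℝ) = nhds (∑ i, p i) := by rw [h.sum_eq]
    rw [hsum]
    refine tendsto_finsetSum _ fun i _ => ?_
    suffices Filter.Tendsto (fun Λ : ℝ => shiftedCdf σ Λ 1 1 (c i)) Filter.atTop (nhds 1) by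
      simpa using this.const_mul (p i)
    rcases (h.value_nonneg i).eq_or_lt with hc | hc
    · simp only [shiftedCdf, ← hc, if_true]; exact tendsto_const_nhds
    · simp only [shiftedCdf_coe hc.ne']
      exact (tendsto_cdf_atTop _).comp (Filter.tendsto_atTop_add_const_right _ _
        (Filter.tendsto_id.atTop_mul_const (div_pos hσ hc)))
  have hbot : Filter.Tendsto (fun Λ : ℝ => ∑ i, p i * shiftedCdf σ Λ 0 1 (c i)) Filter.atBot
      (nhds 0) := by
    rw [← Finset.sum_const_zero (s := (Finset.univ : Finset ι))]
    refine tendsto_finsetSum _ fun i _ => ?_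
    suffices Filter.Tendsto (fun Λ : ℝ => shiftedCdf σ Λ 0 1 (c i)) Filter.atBot (nhds 0) by
      simpa using this.const_mul (p i)
    rcases (h.value_nonneg i).eq_or_lt with hc | hc
    · simp only [shiftedCdf, ← hc, if_true]; exact tendsto_const_nhds
    · simp only [shiftedCdf_coe hc.ne']
      exact (tendsto_cdf_atBot _).comp (Filter.tendsto_atBot_add_const_right _ _
        (Filter.tendsto_id.atBot_mul_const (div_pos hσ hc)))
  have hmono : ∀ θ, Monotone fun Λ : ℝ => ∑ i, p i * shiftedCdf σ Λ θ 1 (c i) := fun θ x y hxy =>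
    Finset.sum_le_sum fun i _ => mul_le_mul_of_nonneg_left (by
      rcases (h.value_nonneg i).eq_or_lt with hc | hc
      · simp [shiftedCdf, ← hc]
      · rw [shiftedCdf_coe hc.ne', shiftedCdf_coe hc.ne']
        exact monotone_cdf _ (by gcongr)) (h.nonneg i)
  have hcontθ : Continuous fun θ => ∑ i, p i * shiftedCdf σ (0 : ℝ) θ 1 (c i) := by
    refine continuous_finsetSum _ fun i _ => continuous_const.mul ?_
    unfold shiftedCdf
    split_ifs
    exacts [continuous_id, continuous_const]
  -- At `Λ = 0` the sum jumps by the mass of `c = 0`. If `1 - α` lies below or above the jump, the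
  -- solution has `Λ < 0` or `Λ > 0`; otherwise `Λ = 0` and `θ` interpolates.
  rcases lt_or_ge (1 - α) (∑ i, p i * shiftedCdf σ (0 : ℝ) 0 1 (c i)) with hlt | hge
  · obtain ⟨x, hx⟩ := (hbot.eventually_lt_const (show 0 < 1 - α by linarith)).exists
    obtain ⟨Λ, hΛ⟩ := mem_range_of_exists_le_of_exists_ge (hcont 0) ⟨x, hx.le⟩ ⟨0, hlt.le⟩
    have hneg : Λ < 0 := (hmono 0).reflect_lt (by simpa only [hΛ] using hlt)
    refine ⟨Λ, 0, by simp, fun h' => absurd h' ?_, fun _ => rfl, by rw [htsum, ← hΛ]⟩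
    exact not_lt.2 (by exact_mod_cast hneg.le)
  rcases lt_or_ge (∑ i, p i * shiftedCdf σ (0 : ℝ) 1 1 (c i)) (1 - α) with hlt | hge'
  · obtain ⟨x, hx⟩ := (htop.eventually_const_lt (show 1 - α < 1 by linarith)).exists
    obtain ⟨Λ, hΛ⟩ := mem_range_of_exists_le_of_exists_ge (hcont 1) ⟨0, hlt.le⟩ ⟨x, hx.le⟩
    have hpos : 0 < Λ := (hmono 1).reflect_lt (by simpa only [hΛ] using hlt)
    refine ⟨Λ, 1, by simp, fun _ => rfl, fun h' => absurd h' ?_, by rw [htsum, ← hΛ]⟩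
    exact not_lt.2 (by exact_mod_cast hpos.le)
  · obtain ⟨θ, hθ, hθe⟩ := intermediate_value_Icc zero_le_one hcontθ.continuousOn ⟨hge, hge'⟩
    exact ⟨(0 : ℝ), θ, hθ, by simp, by simp, by rw [htsum, ← hθe]⟩

lemma mixtureTradeoff_eq (h : HasFiniteLaw 𝒞 q p c) (hσ : 0 < σ)
    (hΛ : IsThreshold 𝒞 q σ α Λ θ) : mixtureTradeoff 𝒞 q σ α = thresholdValue 𝒞 q σ Λ θ := by
  have hex : ∃ p : EReal × ℝ, IsThreshold 𝒞 q σ α p.1 p.2 := ⟨(Λ, θ), hΛ⟩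
  rw [mixtureTradeoff, dif_pos hex]
  exact (h.isLUB_thresholdValue hσ hex.choose_spec).unique (h.isLUB_thresholdValue hσ hΛ)

lemma isConjugate_mixtureTradeoff (h : HasFiniteLaw 𝒞 q p c) (hσ : 0 < σ) :
    IsConjugate (mixtureRisk p (fun i => c i) σ) (mixtureTradeoff 𝒞 q σ) := fun α hα => by
  obtain ⟨Λ, θ, hΛ⟩ := h.exists_isThreshold hσ hα
  rw [h.mixtureTradeoff_eq hσ hΛ]
  exact h.isLUB_thresholdValue hσ hΛ

lemma isSymmetricTradeoffFunction_mixtureTradeoff (h : HasFiniteLaw 𝒞 q p c) (hσ : 0 < σ) :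
    IsSymmetricTradeoffFunction (mixtureTradeoff 𝒞 q σ) := by
  refine (h.isConjugate_mixtureTradeoff hσ).isSymmetricTradeoffFunction ?_ (fun k _ => ?_)
    (fun k hk => ?_) fun k hk => ?_
  · simp [mixtureRisk, gaussianRisk_of_nonpos]
  · rw [mixtureRisk, ← h.sum_eq]
    exact Finset.sum_le_sum fun i _ =>
      mul_le_of_le_one_right (h.nonneg i) (gaussianRisk_le_one _ _)
  · calc mixtureRisk p (fun i => c i) σ k ≤ ∑ i, p i * k := Finset.sum_le_sum fun i _ =>
          mul_le_mul_of_nonneg_left (gaussianRisk_le _ hk) (h.nonneg i)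
      _ = k := by rw [← Finset.sum_mul, h.sum_eq, one_mul]
  · rw [mixtureRisk, mixtureRisk, Finset.mul_sum]
    refine Finset.sum_congr rfl fun i _ => ?_
    rw [gaussianRisk_inv _ hk]
    ring

-- Components with `c ≤ cL` have at least the risk of `cL`. For the others, of total mass at most
-- `l`, replacing the risk of `cL` by `0` loses at most `min 1 k`.
open Classical in
lemma lowerBound_le_mixtureTradeoff (h : HasFiniteLaw 𝒞 q p c) (hσ : 0 < σ) {cL l : ℝ}
    (hcL : 0 ≤ cL) (hl0 : 0 ≤ l) (hl : (∑ i, if cL < c i then p i else 0) ≤ l)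
    (hα : α ∈ Icc (0 : ℝ) 1) : lowerBound σ cL l α ≤ mixtureTradeoff 𝒞 q σ α := by
  refine (isConjugate_lowerBound (div_nonneg hcL hσ.le) hl0).mono
    (h.isConjugate_mixtureTradeoff hσ) (fun k hk => max_le ?_ ?_) hα
  · exact Finset.sum_nonneg fun i _ => mul_nonneg (h.nonneg i) (gaussianRisk_nonneg _ _)
  have hmin : 0 ≤ min 1 k := le_min zero_le_one hk
  rw [sub_le_iff_le_add]
  calc gaussianRisk (cL / σ) k = ∑ i, p i * gaussianRisk (cL / σ) k := by
        rw [← Finset.sum_mul, h.sum_eq, one_mul]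
    _ ≤ ∑ i, (p i * gaussianRisk (c i / σ) k + (if cL < c i then p i else 0) * min 1 k) := by
        refine Finset.sum_le_sum fun i _ => ?_
        split_ifs with hc
        · nlinarith [mul_le_mul_of_nonneg_left (gaussianRisk_le_min (cL / σ) hk) (h.nonneg i),
            mul_nonneg (h.nonneg i) (gaussianRisk_nonneg (c i / σ) k)]
        · rw [zero_mul, add_zero]
          exact mul_le_mul_of_nonneg_left (gaussianRisk_anti
            (div_nonneg (h.value_nonneg i) hσ.le) (by gcongr; exact not_lt.1 hc) k) (h.nonneg i)
    _ ≤ mixtureRisk p (fun i => c i) σ k + l * min 1 k := by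
        rw [Finset.sum_add_distrib, ← Finset.sum_mul]
        exact add_le_add_right (mul_le_mul_of_nonneg_right hl hmin) _

end HasFiniteLaw

/-! ### Adaptive composition -/

lemma lintegral_pi_fin_cons {X : Type*} [MeasurableSpace X] (μ : Measure X) [SigmaFinite μ] {n : ℕ}
    {G : (Fin (n + 1) → X) → ℝ≥0∞} (hG : Measurable G) :
    ∫⁻ z, G z ∂Measure.pi (fun _ => μ)
      = ∫⁻ x, ∫⁻ z, G (Fin.cons x z) ∂Measure.pi (fun _ => μ) ∂μ := by
  have h := measurePreserving_piFinSuccAbove (fun _ : Fin (n + 1) => μ) 0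
  rw [← h.symm.lintegral_comp hG, 
    lintegral_prod (fun p => G ((MeasurableEquiv.piFinSuccAbove (fun _ => X) 0).symm p))
      (hG.comp h.symm.measurable).aemeasurable]
  simp [MeasurableEquiv.piFinSuccAbove, Fin.insertNthEquiv]

lemma measurable_fin_cons {X : Type*} [MeasurableSpace X] {n : ℕ} :
    Measurable fun p : X × (Fin n → X) => (Fin.cons p.1 p.2 : Fin (n + 1) → X) := by
  refine measurable_pi_iff.2 fun i => ?_
  induction i using Fin.cases with
  | zero => simpa using measurable_fst
  | succ i => simpa [Function.comp_def] using (measurable_pi_apply i).comp measurable_snd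

lemma lintegral_gaussianReal_scale {τ : ℝ} {h : ℝ → ℝ≥0∞} (hh : Measurable h) :
    ∫⁻ x, h x ∂gaussianReal 0 (τ ^ 2).toNNReal = ∫⁻ x, h (τ * x) ∂gaussianReal 0 1 := by
  rw [← lintegral_map hh (measurable_const_mul τ), gaussianReal_map_const_mul, mul_zero, mul_one]
  congr 2
  exact Real.toNNReal_of_nonneg (sq_nonneg τ)

lemma gaussianBayes_le_lintegral_add_scale {τ : ℝ} (hτ : 0 < τ) (v s : ℝ) {G₁ G₂ : ℝ → ℝ≥0∞}
    (h₁ : Measurable G₁) (h₂ : Measurable G₂)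
    (h : ∀ z, ∀ a b : ℝ≥0∞, gaussianBayes s a b ≤ a * G₁ z + b * G₂ z) (a b : ℝ≥0∞) :
    gaussianBayes (√((v / τ) ^ 2 + s ^ 2)) a b
      ≤ a * ∫⁻ z, G₁ (v + z) ∂gaussianReal 0 (τ ^ 2).toNNReal
        + b * ∫⁻ z, G₂ z ∂gaussianReal 0 (τ ^ 2).toNNReal := by
  have h' := gaussianBayes_le_lintegral_add (v / τ) s (h₁.comp (measurable_const_mul τ))
    (h₂.comp (measurable_const_mul τ)) (fun z => h (τ * z)) a b
  simp only [Function.comp_def, mul_add, mul_div_cancel₀ v hτ.ne'] at h'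
  rwa [lintegral_gaussianReal_scale (h := fun z => G₁ (v + z)) (by fun_prop),
    lintegral_gaussianReal_scale h₂]

/-- A shift of a Gaussian vector by `v` contributes `‖v‖² / τ²` to the squared separation. -/
lemma gaussianBayes_le_lintegral_pi {τ : ℝ} (hτ : 0 < τ) {s : ℝ} (hs : 0 ≤ s) :
    ∀ {n : ℕ} (v : Fin n → ℝ) {G₁ G₂ : (Fin n → ℝ) → ℝ≥0∞}, Measurable G₁ → Measurable G₂ →
      (∀ z, ∀ a b : ℝ≥0∞, gaussianBayes s a b ≤ a * G₁ z + b * G₂ z) → ∀ a b : ℝ≥0∞,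
      gaussianBayes (√(∑ i, (v i / τ) ^ 2 + s ^ 2)) a b
        ≤ a * ∫⁻ z, G₁ (v + z) ∂Measure.pi (fun _ => gaussianReal 0 (τ ^ 2).toNNReal)
          + b * ∫⁻ z, G₂ z ∂Measure.pi (fun _ => gaussianReal 0 (τ ^ 2).toNNReal)
  | 0, v, G₁, G₂, h₁, h₂, h, a, b => by
    have e₁ : ∀ z, G₁ (v + z) = G₁ v := fun z => congrArg G₁ (Subsingleton.elim _ _)
    have e₂ : ∀ z, G₂ z = G₂ v := fun z => congrArg G₂ (Subsingleton.elim _ _)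
    simp only [e₁, e₂, lintegral_const, measure_univ, mul_one]
    simpa [Real.sqrt_sq hs] using h v a b
  | n + 1, v, G₁, G₂, h₁, h₂, h, a, b => by
    have hcons : ∀ x z, v + (Fin.cons x z : Fin (n + 1) → ℝ)
        = Fin.cons (v 0 + x) (Fin.tail v + z) := fun x z => by
      refine funext fun i => ?_
      induction i using Fin.cases <;> simp [Fin.tail]
    have hm : Measurable fun z => G₁ (v + z) := h₁.comp (measurable_const_add v)
    rw [lintegral_pi_fin_cons _ hm, lintegral_pi_fin_cons _ h₂]
    simp only [hcons]
    have hg₁ : Measurable fun p : ℝ × (Fin n → ℝ) =>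
        G₁ (Fin.cons p.1 (Fin.tail v + p.2)) :=
      h₁.comp (measurable_fin_cons.comp (measurable_fst.prodMk (measurable_snd.const_add _)))
    have key := gaussianBayes_le_lintegral_add_scale hτ (v 0)
      (√(∑ i, (Fin.tail v i / τ) ^ 2 + s ^ 2)) hg₁.lintegral_prod_right'
      (h₂.comp measurable_fin_cons).lintegral_prod_right'
      (fun x => gaussianBayes_le_lintegral_pi hτ hs (Fin.tail v)
        (h₁.comp (measurable_fin_cons.comp measurable_prodMk_left))
        (h₂.comp (measurable_fin_cons.comp measurable_prodMk_left)) fun z => h _) a b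
    rw [Real.sq_sqrt (by positivity), ← add_assoc] at key
    rw [Fin.sum_univ_succ]
    exact key

section Fold

variable {S : Type*} [MeasurableSpace S] {V : Type*} [MeasurableSpace V]

/-- Measurability is joint in the randomness, the initial state and the noise, so that Fubini
applies and the induction can change the initial state. -/
lemma measurable_fin_foldl {Ω : Type*} [MeasurableSpace Ω] : ∀ {T : ℕ}
    (step : Fin T → Ω → S → V → S)
    (_ : ∀ t, Measurable fun p : Ω × S × V => step t p.1 p.2.1 p.2.2),
    Measurable fun p : Ω × S × (Fin T → V) =>
      Fin.foldl T (fun st t => step t p.1 st (p.2.2 t)) p.2.1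
  | 0, _, _ => by
    simpa [Function.comp_def] using measurable_fst.comp measurable_snd
  | T + 1, step, h => by
    simp only [Fin.foldl_succ]
    have ih := measurable_fin_foldl (fun t => step t.succ) fun t => h t.succ
    have hp : Measurable fun p : Ω × S × (Fin (T + 1) → V) =>
        (p.1, step 0 p.1 p.2.1 (p.2.2 0), fun t : Fin T => p.2.2 t.succ) := by
      refine measurable_fst.prodMk (Measurable.prodMk ?_ ?_)
      · exact (h 0).comp (measurable_fst.prodMk ((measurable_fst.comp measurable_snd).prodMk
          ((measurable_pi_apply 0).comp (measurable_snd.comp measurable_snd))))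
      · exact measurable_pi_iff.2 fun t =>
          (measurable_pi_apply t.succ).comp (measurable_snd.comp measurable_snd)
    exact ih.comp hp

/-- Adaptive composition of Gaussian mechanisms: if the two mechanisms differ in step `t` by a shift
of the noise of length at most `d t` times the standard deviation, then testing them against each
other is at least as hard as testing `N(0,1)` against `N((∑ d²)^(1/2), 1)`. -/
lemma gaussianBayes_le_foldl {τ : ℝ} (hτ : 0 < τ) {n : ℕ} {G₁ G₂ : S → ℝ≥0∞} (h₁ : Measurable G₁)
    (h₂ : Measurable G₂) (h : ∀ st, ∀ a b : ℝ≥0∞, min a b ≤ a * G₁ st + b * G₂ st) :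
    ∀ {T : ℕ} (stepP stepQ : Fin T → S → (Fin n → ℝ) → S) (d : Fin T → ℝ)
      (_ : ∀ t, Measurable fun p : S × (Fin n → ℝ) => stepP t p.1 p.2)
      (_ : ∀ t, Measurable fun p : S × (Fin n → ℝ) => stepQ t p.1 p.2)
      (_ : ∀ t st, ∃ v : Fin n → ℝ, ∑ i, (v i / τ) ^ 2 ≤ d t ^ 2 ∧
        ∀ z, stepQ t st z = stepP t st (v + z)) (st : S) (a b : ℝ≥0∞),
      gaussianBayes (√(∑ t, d t ^ 2)) a b
        ≤ a * ∫⁻ z, G₁ (Fin.foldl T (fun st t => stepQ t st (z t)) st)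
            ∂Measure.pi (fun _ => Measure.pi fun _ => gaussianReal 0 (τ ^ 2).toNNReal)
          + b * ∫⁻ z, G₂ (Fin.foldl T (fun st t => stepP t st (z t)) st)
            ∂Measure.pi (fun _ => Measure.pi fun _ => gaussianReal 0 (τ ^ 2).toNNReal)
  | 0, stepP, stepQ, d, hP, hQ, hd, st, a, b => by simpa using h st a b
  | T + 1, stepP, stepQ, d, hP, hQ, hd, st, a, b => by
    have hfold : ∀ {T : ℕ} (step : Fin T → S → (Fin n → ℝ) → S)
        (_ : ∀ t, Measurable fun p : S × (Fin n → ℝ) => step t p.1 p.2),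
        Measurable fun p : S × (Fin T → Fin n → ℝ) =>
          Fin.foldl T (fun st t => step t st (p.2 t)) p.1 := fun step hs =>
      (measurable_fin_foldl (Ω := Unit) (fun t _ => step t)
        fun t => (hs t).comp measurable_snd).comp ((measurable_const (a := ())).prodMk measurable_id)
    obtain ⟨v, hv, hshift⟩ := hd 0 st
    have hmQ := h₁.comp ((hfold stepQ hQ).comp (measurable_prodMk_left (x := st)))
    have hmP := h₂.comp ((hfold stepP hP).comp (measurable_prodMk_left (x := st)))
    simp only [Function.comp_def] at hmQ hmP
    rw [lintegral_pi_fin_cons _ hmQ, lintegral_pi_fin_cons _ hmP]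
    -- After this both programs pass through states `stepP 0 st y`, with `y = v + z` for one and `y
    -- = z` for the other. The induction hypothesis can thus be applied from a common state for each
    -- `y`, which is what allows later steps to be adaptive.
    simp only [Fin.foldl_succ, Fin.cons_zero, Fin.cons_succ, hshift]
    have hinner₁ := (h₁.comp (hfold (fun t => stepQ t.succ)
      fun t => hQ t.succ)).lintegral_prod_right'
      (ν := Measure.pi fun _ => Measure.pi fun _ => gaussianReal 0 (τ ^ 2).toNNReal)
    have hinner₂ := (h₂.comp (hfold (fun t => stepP t.succ)
      fun t => hP t.succ)).lintegral_prod_right'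
      (ν := Measure.pi fun _ => Measure.pi fun _ => gaussianReal 0 (τ ^ 2).toNNReal)
    have hst : Measurable fun y => stepP 0 st y := (hP 0).comp measurable_prodMk_left
    have key := gaussianBayes_le_lintegral_pi hτ (Real.sqrt_nonneg (∑ t : Fin T, d t.succ ^ 2)) v
      (hinner₁.comp hst) (hinner₂.comp hst)
      (fun y => gaussianBayes_le_foldl hτ h₁ h₂ h (fun t => stepP t.succ) (fun t => stepQ t.succ)
        (fun t => d t.succ) (fun t => hP t.succ) (fun t => hQ t.succ) (fun t => hd t.succ)
        (stepP 0 st y)) a b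
    refine (gaussianBayes_anti (Real.sqrt_nonneg _) (Real.sqrt_le_sqrt ?_) a b).trans key
    rw [Real.sq_sqrt (Finset.sum_nonneg fun t _ => sq_nonneg _), Fin.sum_univ_succ (n := T)]
    gcongr

end Fold

/-! ### The distribution of the hit counts -/

section Sampling

variable {N m s E : ℕ} (smp : Sampler N m s)

lemma sum_drawProb : ∑ π : Fin E → Equiv.Perm (Fin N), ∑ S : Fin E → EpochSample N m s,
    drawProb smp π S = 1 := by
  have hPMF : ∀ {α : Type} [Fintype α] [DecidableEq α] (q : PMF α),
      ∑ x : Fin E → α, ∏ e, q (x e) = 1 := fun {α} _ _ q => by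
    have h := Finset.prod_univ_sum (fun _ : Fin E => (Finset.univ : Finset α)) fun _ a => q a
    rw [Fintype.piFinset_univ] at h
    rw [← h, ← tsum_fintype (L := .unconditional _), q.tsum_coe]
    simp
  simp only [drawProb, Finset.prod_mul_distrib, ← Finset.mul_sum, hPMF, mul_one]

lemma drawProb_ne_top (π : Fin E → Equiv.Perm (Fin N)) (S : Fin E → EpochSample N m s) :
    drawProb smp π S ≠ ∞ :=
  ENNReal.prod_ne_top fun _ _ => ENNReal.mul_ne_top (PMF.apply_ne_top _ _) (PMF.apply_ne_top _ _)

lemma drawProb_mul_left (τ : Equiv.Perm (Fin N)) (π : Fin E → Equiv.Perm (Fin N))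
    (S : Fin E → EpochSample N m s) : drawProb smp (fun e => τ * π e) S = drawProb smp π S := by
  simp [drawProb]

/-- The joint outcomes of the permutations and of the sampling procedure. -/
abbrev Draw (N m s E : ℕ) : Type :=
  (Fin E → Equiv.Perm (Fin N)) × (Fin E → EpochSample N m s)

/-- The probability of an outcome as a real number. -/
def drawWeight (x : Draw N m s E) : ℝ := (drawProb smp x.1 x.2).toReal

lemma ofReal_drawWeight (x : Draw N m s E) :
    ENNReal.ofReal (drawWeight smp x) = drawProb smp x.1 x.2 :=
  ENNReal.ofReal_toReal (drawProb_ne_top smp _ _)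

/-- The value of `c` for a given outcome. -/
def drawSens (g : ℕ) (x : Draw N m s E) : sensSet g :=
  ⟨√(∑ k ∈ Finset.Icc 1 g, (roundCount g x.1 x.2 k : ℝ) * (k : ℝ) ^ 2), _, rfl⟩

lemma drawSens_nonneg (g : ℕ) (x : Draw N m s E) : 0 ≤ (drawSens g x : ℝ) := Real.sqrt_nonneg _

lemma nonneg_of_mem_sensSet {g : ℕ} {c : ℝ} (hc : c ∈ sensSet g) : 0 ≤ c := by
  obtain ⟨a, rfl⟩ := hc
  exact Real.sqrt_nonneg _

open Classical in
lemma sensProb_eq_sum (g : ℕ) {c : ℝ} (hc : 0 ≤ c) :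
    sensProb smp E g c
      = ∑ x : Draw N m s E, if c = drawSens g x then drawWeight smp x else 0 := by
  rw [sensProb, ← Fintype.sum_prod_type', ENNReal.toReal_sum]
  · refine Finset.sum_congr rfl fun x _ => ?_
    have h0 : 0 ≤ ∑ k ∈ Finset.Icc 1 g, (roundCount g x.1 x.2 k : ℝ) * (k : ℝ) ^ 2 :=
      Finset.sum_nonneg fun k _ => by positivity
    have hiff : c = drawSens g x
        ↔ c ^ 2 = ∑ k ∈ Finset.Icc 1 g, (roundCount g x.1 x.2 k : ℝ) * (k : ℝ) ^ 2 := by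
      rw [drawSens, eq_comm, Real.sqrt_eq_iff_eq_sq h0 hc, eq_comm]
    simp only [hiff]
    split_ifs <;> rfl
  · intro x _
    split_ifs
    exacts [drawProb_ne_top smp _ _, ENNReal.zero_ne_top]

-- Only finitely many `c` have positive probability, so the series over a possibly infinite set is a
-- finite sum over draws. The set `D` is arbitrary in order to cover both `sensSet g` and its part
-- above `cL`.
open Classical in
lemma tsum_sensProb_mul (g : ℕ) {D : Set ℝ} (hD : ∀ c ∈ D, 0 ≤ c) (F : D → ℝ) :
    ∑' c : D, sensProb smp E g c * F c = ∑ x : Draw N m s E,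
      if h : (drawSens g x : ℝ) ∈ D then drawWeight smp x * F ⟨drawSens g x, h⟩ else 0 := by
  refine HasSum.tsum_eq ?_
  have hterm : ∀ x : Draw N m s E,
      HasSum (fun c : D => (if (c : ℝ) = drawSens g x then drawWeight smp x else 0) * F c)
        (if h : (drawSens g x : ℝ) ∈ D then drawWeight smp x * F ⟨drawSens g x, h⟩ else 0) := by
    intro x
    split_ifs with h
    · have hs := hasSum_single (f := fun c : D =>
        (if (c : ℝ) = drawSens g x then drawWeight smp x else 0) * F c) ⟨drawSens g x, h⟩
        fun c hc => by
          rw [if_neg fun h' => hc (Subtype.ext h'), zero_mul]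
      simpa using hs
    · have hz : (fun c : D => (if (c : ℝ) = drawSens g x then drawWeight smp x else 0) * F c)
          = fun _ => 0 := funext fun c => by
        rw [if_neg fun h' : (c : ℝ) = drawSens g x => h (h' ▸ c.2), zero_mul]
      rw [hz]
      exact hasSum_zero
  have hsum := hasSum_sum (s := Finset.univ) fun x _ => hterm x
  have hfun : (fun c : D => sensProb smp E g c * F c) = fun c : D => ∑ x : Draw N m s E,
      (if (c : ℝ) = drawSens g x then drawWeight smp x else 0) * F c := funext fun c => by
    rw [sensProb_eq_sum smp g (hD c c.2), Finset.sum_mul]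
  rw [hfun]
  exact hsum

lemma hasFiniteLaw_sensProb (E g : ℕ) :
    HasFiniteLaw (sensSet g) (sensProb smp E g) (drawWeight (E := E) smp) (drawSens g) where
  nonneg _ := ENNReal.toReal_nonneg
  sum_eq := by
    simp only [drawWeight]
    rw [← ENNReal.toReal_sum fun x _ => drawProb_ne_top smp _ _, Fintype.sum_prod_type,
      sum_drawProb, ENNReal.toReal_one]
  value_nonneg := drawSens_nonneg g
  tsum_eq F := by
    rw [tsum_sensProb_mul smp g (fun c hc => nonneg_of_mem_sensSet hc)]
    exact Finset.sum_congr rfl fun x _ => dif_pos (drawSens g x).2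

open Classical in
lemma tsum_sensProb_gt (g : ℕ) (cL : ℝ) :
    ∑' c : {c : ℝ | c ∈ sensSet g ∧ cL < c}, sensProb smp E g c
      = ∑ x : Draw N m s E, if cL < drawSens g x then drawWeight smp x else 0 := by
  have h := tsum_sensProb_mul (E := E) smp g (D := {c : ℝ | c ∈ sensSet g ∧ cL < c})
    (fun c hc => nonneg_of_mem_sensSet hc.1) fun _ => 1
  simp only [mul_one] at h
  rw [h]
  refine Finset.sum_congr rfl fun x _ => ?_
  simp [(drawSens g x).2]

variable {smp}

lemma mem_support_of_drawProb_ne_zero {x : Draw N m s E} (hx : drawProb smp x.1 x.2 ≠ 0)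
    (e : Fin E) : x.2 e ∈ smp.law.support :=
  (PMF.mem_support_iff _ _).2 (right_ne_zero_of_mul (Finset.prod_ne_zero_iff.1 hx e
    (Finset.mem_univ e)))

/-- The sets of a round are disjoint in a draw of positive probability, so distinct hit sets contain
distinct preimages of the first `g` indices. -/
lemma hitCount_le {x : Draw N m s E} (hx : drawProb smp x.1 x.2 ≠ 0) (g : ℕ)
    (b : Fin (roundsPerEpoch N m s)) (e : Fin E) : hitCount g x.1 x.2 b e ≤ g := by
  classical
  have hex : ∀ h : Fin m, h ∈ (Finset.univ.filter fun h : Fin m =>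
      ∃ i ∈ x.2 e b h, (x.1 e i : ℕ) < g) → ∃ j : ℕ, j < g ∧ ∃ i ∈ x.2 e b h, (x.1 e i : ℕ) = j :=
    fun h hh => by
      obtain ⟨-, i, hi, hlt⟩ := Finset.mem_filter.1 hh
      exact ⟨_, hlt, i, hi, rfl⟩
  choose! j hj hi using hex
  refine LE.le.trans_eq ?_ (Finset.card_range g)
  refine Finset.card_le_card_of_injOn j
    (fun h hh => Finset.mem_coe.2 (Finset.mem_range.2 (hj h hh))) fun h hh h' hh' heq => ?_
  by_contra hne
  obtain ⟨i, hmem, hij⟩ := hi h hh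
  obtain ⟨i', hmem', hij'⟩ := hi h' hh'
  have hdisj := smp.disjoint _ (mem_support_of_drawProb_ne_zero hx e) b h h' hne
  have hii : i = i' := (x.1 e).injective (Fin.val_injective (by rw [hij, hij', heq]))
  exact Finset.disjoint_left.1 hdisj hmem (hii ▸ hmem')

lemma hitCount_mono {g g' : ℕ} (hg : g ≤ g') (x : Draw N m s E)
    (b : Fin (roundsPerEpoch N m s)) (e : Fin E) :
    hitCount g x.1 x.2 b e ≤ hitCount g' x.1 x.2 b e :=
  Finset.card_le_card fun h hh => by
    obtain ⟨-, i, hi, hlt⟩ := Finset.mem_filter.1 hh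
    exact Finset.mem_filter.2 ⟨Finset.mem_univ _, i, hi, hlt.trans_le hg⟩

/-- Grouping the rounds by their hit count loses nothing: counts above `g` do not occur, and rounds
with count `0` contribute `0`. -/
lemma drawSens_eq {x : Draw N m s E} (hx : drawProb smp x.1 x.2 ≠ 0) (g : ℕ) :
    (drawSens g x : ℝ) = √(∑ p : Fin (roundsPerEpoch N m s) × Fin E,
      (hitCount g x.1 x.2 p.1 p.2 : ℝ) ^ 2) := by
  refine congrArg Real.sqrt ?_
  calc ∑ k ∈ Finset.Icc 1 g, (roundCount g x.1 x.2 k : ℝ) * (k : ℝ) ^ 2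
      = ∑ k ∈ Finset.Icc 1 g, ∑ p : Fin (roundsPerEpoch N m s) × Fin E,
          if hitCount g x.1 x.2 p.1 p.2 = k then (hitCount g x.1 x.2 p.1 p.2 : ℝ) ^ 2 else 0 := by
        refine Finset.sum_congr rfl fun k _ => ?_
        rw [roundCount, Finset.card_filter, Nat.cast_sum, Finset.sum_mul]
        refine Finset.sum_congr rfl fun p _ => ?_
        split_ifs with h <;> simp [h]
    _ = _ := by
        rw [Finset.sum_comm]
        refine Finset.sum_congr rfl fun p _ => ?_
        rw [Finset.sum_ite_eq]
        split_ifs with h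
        · rfl
        · have h0 : hitCount g x.1 x.2 p.1 p.2 = 0 := by
            have := hitCount_le hx g p.1 p.2
            rw [Finset.mem_Icc] at h
            omega
          simp [h0]

lemma drawSens_mono {x : Draw N m s E} (hx : drawProb smp x.1 x.2 ≠ 0) {g g' : ℕ} (hg : g ≤ g') :
    (drawSens g x : ℝ) ≤ drawSens g' x := by
  rw [drawSens_eq hx, drawSens_eq hx]
  refine Real.sqrt_le_sqrt (Finset.sum_le_sum fun p _ => ?_)
  have := hitCount_mono hg x p.1 p.2
  gcongr

/-- A coupling: the same draw is used for `g` and `g'`, and its separation grows with the group. -/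
lemma sampledTradeoff_anti (smp : Sampler N m s) {σ : ℝ} (hσ : 0 < σ) {g g' : ℕ} (hg : g ≤ g')
    {α : ℝ} (hα : α ∈ Icc (0 : ℝ) 1) :
    sampledTradeoff smp E g' σ α ≤ sampledTradeoff smp E g σ α := by
  refine ((hasFiniteLaw_sensProb smp E g').isConjugate_mixtureTradeoff hσ).mono
    ((hasFiniteLaw_sensProb smp E g).isConjugate_mixtureTradeoff hσ)
    (fun k _ => Finset.sum_le_sum fun x _ => ?_) hα
  by_cases hx : drawProb smp x.1 x.2 = 0
  · simp [drawWeight, hx]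
  · exact mul_le_mul_of_nonneg_left (gaussianRisk_anti (div_nonneg (drawSens_nonneg g x) hσ.le)
      (div_le_div_of_nonneg_right (drawSens_mono hx hg) hσ.le) k) ENNReal.toReal_nonneg

end Sampling

/-! ### Clipping and the rounds of the mechanism -/

lemma norm_clip_le {n : ℕ} {C : ℝ} (hC : 0 < C) (x : ModelSpace n) : ‖clip C x‖ ≤ C := by
  have h0 : 0 < max 1 (‖x‖ / C) := lt_max_of_lt_left one_pos
  rw [clip, norm_smul, norm_inv, Real.norm_of_nonneg h0.le, inv_mul_le_iff₀ h0,
    ← div_le_iff₀ hC]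
  exact le_max_right _ _

lemma measurable_clip {n : ℕ} (C : ℝ) : Measurable (clip C : ModelSpace n → ModelSpace n) := by
  unfold clip
  fun_prop

namespace LocalProgram

variable {X Ω : Type*} [MeasurableSpace Ω] {n N : ℕ} (A : LocalProgram X Ω n N)

lemma measurable_roundModel (t : ℕ) : ∀ h, Measurable
    fun p : Ω × (ℕ → ModelSpace n) × ModelSpace n => A.roundModel t p.1 p.2.1 p.2.2 h
  | 0 => measurable_snd.comp measurable_snd
  | h + 1 => (A.measurable_isr t h).comp (measurable_fst.prodMk
      ((measurable_fst.comp measurable_snd).prodMk (measurable_roundModel t h)))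

/-- The sum `∑_h [a_h]_C` of the clipped results of a round. -/
def clippedSum (m : ℕ) (C : ℝ) (t : ℕ) (ω : Ω) (ξ : Fin m → Fin N → Option X)
    (st : (ℕ → ModelSpace n) × ModelSpace n) : ModelSpace n :=
  ∑ h : Fin m, clip C (A.update t h ω st.1 (A.roundModel t ω st.1 st.2 (h + 1)) (ξ h))

lemma round_eq (m : ℕ) (C : ℝ) (t : ℕ) (ω : Ω) (z : ModelSpace n) (ξ : Fin m → Fin N → Option X)
    (st : (ℕ → ModelSpace n) × ModelSpace n) :
    A.round m C t ω z ξ st =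
      (Function.update st.1 t ((m : ℝ)⁻¹ • (A.clippedSum m C t ω ξ st + z)),
        A.isr t m ω (Function.update st.1 t ((m : ℝ)⁻¹ • (A.clippedSum m C t ω ξ st + z)))
          (A.roundModel t ω st.1 st.2 m)
        - A.stepSize t • (m : ℝ)⁻¹ • (A.clippedSum m C t ω ξ st + z)) := rfl

lemma measurable_clippedSum (m : ℕ) (C : ℝ) (t : ℕ) (ξ : Fin m → Fin N → Option X) :
    Measurable fun p : Ω × (ℕ → ModelSpace n) × ModelSpace n => A.clippedSum m C t p.1 ξ p.2 :=
  Finset.measurable_fun_sum _ fun h _ => (measurable_clip C).comp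
    ((A.measurable_update t h (ξ h)).comp (measurable_fst.prodMk
      ((measurable_fst.comp measurable_snd).prodMk (A.measurable_roundModel t (h + 1)))))

lemma measurable_round (m : ℕ) (C : ℝ) (t : ℕ) (ξ : Fin m → Fin N → Option X) :
    Measurable fun p : Ω × ((ℕ → ModelSpace n) × ModelSpace n) × (Fin n → ℝ) =>
      A.round m C t p.1 (WithLp.toLp 2 p.2.2) ξ p.2.1 := by
  have hst : Measurable fun p : Ω × ((ℕ → ModelSpace n) × ModelSpace n) × (Fin n → ℝ) =>
      (p.1, p.2.1) := measurable_fst.prodMk (measurable_fst.comp measurable_snd)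
  have hz : Measurable fun p : Ω × ((ℕ → ModelSpace n) × ModelSpace n) × (Fin n → ℝ) =>
      (WithLp.toLp 2 p.2.2 : ModelSpace n) :=
    (WithLp.measurable_toLp 2 _).comp (measurable_snd.comp measurable_snd)
  have hU := (A.measurable_clippedSum m C t ξ).fun_comp hst
  have hV : Measurable fun p : Ω × ((ℕ → ModelSpace n) × ModelSpace n) × (Fin n → ℝ) =>
      (m : ℝ)⁻¹ • (A.clippedSum m C t p.1 ξ p.2.1 + WithLp.toLp 2 p.2.2) :=
    (hU.fun_add hz).fun_const_smul (m : ℝ)⁻¹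
  have hy : Measurable fun p : Ω × ((ℕ → ModelSpace n) × ModelSpace n) × (Fin n → ℝ) =>
      Function.update p.2.1.1 t
        ((m : ℝ)⁻¹ • (A.clippedSum m C t p.1 ξ p.2.1 + WithLp.toLp 2 p.2.2)) :=
    measurable_update'.comp
      ((measurable_fst.comp (measurable_fst.comp measurable_snd)).prodMk hV)
  have hw := (A.measurable_roundModel t m).fun_comp hst
  have hisr := (A.measurable_isr t m).fun_comp (measurable_fst.prodMk (hy.prodMk hw))
  simp only [round_eq]
  exact hy.prodMk (hisr.fun_sub (hV.fun_const_smul (A.stepSize t)))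

/-- A round uses the samples only through `clippedSum + z`, so a change of data acts as a shift of
the noise. -/
lemma round_eq_shift (m : ℕ) (C : ℝ) (t : ℕ) (ω : Ω) (z : ModelSpace n)
    (ξ ξ' : Fin m → Fin N → Option X) (st : (ℕ → ModelSpace n) × ModelSpace n) :
    A.round m C t ω z ξ' st
      = A.round m C t ω (A.clippedSum m C t ω ξ' st - A.clippedSum m C t ω ξ st + z) ξ st := by
  have h : A.clippedSum m C t ω ξ' st + z = A.clippedSum m C t ω ξ st
      + (A.clippedSum m C t ω ξ' st - A.clippedSum m C t ω ξ st + z) := by abel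
  rw [round_eq, round_eq, h]

lemma norm_clippedSum_sub_le {C : ℝ} (hC : 0 < C) (m t : ℕ) (ω : Ω)
    (ξ ξ' : Fin m → Fin N → Option X) (st : (ℕ → ModelSpace n) × ModelSpace n)
    (H : Finset (Fin m)) (hH : ∀ h ∉ H, ξ' h = ξ h) :
    ‖A.clippedSum m C t ω ξ' st - A.clippedSum m C t ω ξ st‖ ≤ 2 * C * H.card := by
  rw [clippedSum, clippedSum, ← Finset.sum_sub_distrib,
    ← Finset.sum_subset (Finset.subset_univ H) fun h _ hh => by rw [hH h hh, sub_self]]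
  refine (norm_sum_le _ _).trans ((Finset.sum_le_card_nsmul H _ (2 * C) fun h _ => ?_).trans
    (by rw [nsmul_eq_mul, mul_comm]))
  refine (norm_sub_le _ _).trans ?_
  linarith [norm_clip_le hC (A.update t h ω st.1 (A.roundModel t ω st.1 st.2 (h + 1)) (ξ' h)),
    norm_clip_le hC (A.update t h ω st.1 (A.roundModel t ω st.1 st.2 (h + 1)) (ξ h))]

variable {m s E : ℕ} (C : ℝ)

/-- The samples that are used in round `t`. -/
def roundSamples (r : Fin N → Option X) (x : Draw N m s E) (t : Fin (E * roundsPerEpoch N m s))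
    (h : Fin m) (i : Fin N) : Option X :=
  if i ∈ x.2 (finProdFinEquiv.symm t).1 (finProdFinEquiv.symm t).2 h
    then r (x.1 (finProdFinEquiv.symm t).1 i) else none

lemma transmitted_eq (r : Fin N → Option X) (x : Draw N m s E) (ω : Ω)
    (z : Fin (E * roundsPerEpoch N m s) → Fin n → ℝ) :
    A.transmitted C r x.1 x.2 ω z = fun j : Fin (E * roundsPerEpoch N m s) => (Fin.foldl (E * roundsPerEpoch N m s)
      (fun st t => A.round m C t ω (WithLp.toLp 2 (z t)) (roundSamples r x t) st)
      ((0 : ℕ → ModelSpace n), A.init)).1 j := rfl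

lemma measurable_transmitted (r : Fin N → Option X) (x : Draw N m s E) :
    Measurable fun p : Ω × (Fin (E * roundsPerEpoch N m s) → Fin n → ℝ) =>
      A.transmitted C r x.1 x.2 p.1 p.2 := by
  simp only [transmitted_eq]
  have h := measurable_fin_foldl
    (fun (t : Fin (E * roundsPerEpoch N m s)) (ω : Ω) st (z : Fin n → ℝ) =>
      A.round m C t ω (WithLp.toLp 2 z) (roundSamples r x t) st)
    fun t => A.measurable_round m C t (roundSamples r x t)
  have h' : Measurable fun p : Ω × (Fin (E * roundsPerEpoch N m s) → Fin n → ℝ) =>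
      (p.1, ((0 : ℕ → ModelSpace n), A.init), p.2) :=
    measurable_fst.prodMk (measurable_const.prodMk measurable_snd)
  have h2 := measurable_fst.comp (h.comp h')
  exact measurable_pi_iff.2 fun j => (measurable_pi_apply (j : ℕ)).comp h2

lemma sum_hitCount_eq (g : ℕ) (x : Draw N m s E) (F : ℕ → ℝ) :
    ∑ t : Fin (E * roundsPerEpoch N m s),
        F (hitCount g x.1 x.2 (finProdFinEquiv.symm t).2 (finProdFinEquiv.symm t).1)
      = ∑ p : Fin (roundsPerEpoch N m s) × Fin E, F (hitCount g x.1 x.2 p.1 p.2) := by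
  rw [finProdFinEquiv.symm.sum_comp fun p => F (hitCount g x.1 x.2 p.2 p.1),
    ← (Equiv.prodComm _ _).sum_comp]
  rfl

/-- For a fixed outcome of the sampling, testing the two mechanisms against each other is at least
as hard as testing `N(0,1)` against `N(c/σ,1)`. -/
lemma gaussianBayes_le_transmitted {C σ : ℝ} (hC : 0 < C) (hσ : 0 < σ) {smp : Sampler N m s} {g : ℕ}
    {x : Draw N m s E} (hx : drawProb smp x.1 x.2 ≠ 0) {r r' : Fin N → Option X}
    (hr : ∀ i : Fin N, g ≤ i → r i = r' i)
    {G₁ G₂ : (Fin (E * roundsPerEpoch N m s) → ModelSpace n) → ℝ≥0∞} (h₁ : Measurable G₁)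
    (h₂ : Measurable G₂) (h : ∀ y, ∀ a b : ℝ≥0∞, min a b ≤ a * G₁ y + b * G₂ y) (ω : Ω)
    (a b : ℝ≥0∞) :
    gaussianBayes (drawSens g x / σ) a b
      ≤ a * ∫⁻ z, G₁ (A.transmitted C r' x.1 x.2 ω z) ∂Measure.pi
          (fun _ => Measure.pi fun _ => gaussianReal 0 ((2 * C * σ) ^ 2).toNNReal)
        + b * ∫⁻ z, G₂ (A.transmitted C r x.1 x.2 ω z) ∂Measure.pi
          (fun _ => Measure.pi fun _ => gaussianReal 0 ((2 * C * σ) ^ 2).toNNReal) := by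
  have hproj : Measurable fun (st : (ℕ → ModelSpace n) × ModelSpace n)
      (j : Fin (E * roundsPerEpoch N m s)) => st.1 j :=
    measurable_pi_iff.2 fun j => (measurable_pi_apply (j : ℕ)).comp measurable_fst
  have hτ : 0 < 2 * C * σ := by positivity
  have hstep : ∀ (r : Fin N → Option X) (t : Fin (E * roundsPerEpoch N m s)),
      Measurable fun p : ((ℕ → ModelSpace n) × ModelSpace n) × (Fin n → ℝ) =>
        A.round m C t ω (WithLp.toLp 2 p.2) (roundSamples r x t) p.1 := fun r t => by
    have h := (A.measurable_round m C t (roundSamples r x t)).fun_comp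
      (measurable_prodMk_left (x := ω))
    exact h
  have hshift : ∀ (t : Fin (E * roundsPerEpoch N m s)) (st : (ℕ → ModelSpace n) × ModelSpace n),
      ∃ v : Fin n → ℝ, ∑ i, (v i / (2 * C * σ)) ^ 2 ≤ ((hitCount g x.1 x.2
        (finProdFinEquiv.symm t).2 (finProdFinEquiv.symm t).1 : ℝ) / σ) ^ 2 ∧
      ∀ z, A.round m C t ω (WithLp.toLp 2 z) (roundSamples r' x t) st
        = A.round m C t ω (WithLp.toLp 2 (v + z)) (roundSamples r x t) st := by
    intro t st
    set δ := A.clippedSum m C t ω (roundSamples r' x t) st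
      - A.clippedSum m C t ω (roundSamples r x t) st with hδ
    refine ⟨δ.ofLp, ?_, fun z => ?_⟩
    · have hnorm : ‖δ‖ ≤ 2 * C * hitCount g x.1 x.2 (finProdFinEquiv.symm t).2
          (finProdFinEquiv.symm t).1 := by
        -- A set without an index that is re-indexed below `g` receives the same samples from `r`
        -- and `r'`, so only the hit sets contribute.
        refine A.norm_clippedSum_sub_le hC m t ω _ _ st _ fun h hh => funext fun i => ?_
        simp only [roundSamples]
        split_ifs with hi
        · refine (hr _ (not_lt.1 fun hlt => hh ?_)).symm
          exact Finset.mem_filter.2 ⟨Finset.mem_univ _, i, hi, hlt⟩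
        · rfl
      simp only [div_pow]
      rw [← Finset.sum_div, ← EuclideanSpace.real_norm_sq_eq, ← div_pow, ← div_pow]
      refine pow_le_pow_left₀ (by positivity) ?_ 2
      -- The shift is at most `2 C L` and the noise level is `2 C σ`, so the clipping constant
      -- cancels.
      rw [div_le_div_iff₀ hτ hσ]
      nlinarith
    · rw [A.round_eq_shift m C t ω (WithLp.toLp 2 z) (roundSamples r x t) (roundSamples r' x t) st,
        ← hδ, WithLp.toLp_add]
  have key := gaussianBayes_le_foldl hτ (h₁.comp hproj) (h₂.comp hproj) (fun st => h _)
    (fun t st z => A.round m C t ω (WithLp.toLp 2 z) (roundSamples r x t) st)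
    (fun t st z => A.round m C t ω (WithLp.toLp 2 z) (roundSamples r' x t) st)
    (fun t => (hitCount g x.1 x.2 (finProdFinEquiv.symm t).2 (finProdFinEquiv.symm t).1 : ℝ) / σ)
    (hstep r) (hstep r') hshift ((0 : ℕ → ModelSpace n), A.init) a b
  have hd : drawSens g x / σ = √(∑ t : Fin (E * roundsPerEpoch N m s), ((hitCount g x.1 x.2
      (finProdFinEquiv.symm t).2 (finProdFinEquiv.symm t).1 : ℝ) / σ) ^ 2) := by
    rw [sum_hitCount_eq g x fun L => ((L : ℝ) / σ) ^ 2, drawSens_eq hx]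
    simp only [div_pow]
    rw [← Finset.sum_div, Real.sqrt_div' _ (sq_nonneg σ), Real.sqrt_sq hσ.le]
  simp only [transmitted_eq, hd]
  exact key

end LocalProgram

/-! ### The mechanism -/

namespace LocalProgram

variable {X Ω : Type*} [MeasurableSpace Ω] {n N m s E : ℕ} (A : LocalProgram X Ω n N)

/-- The distribution of the randomness of the program and of the noise. -/
def noiseMeasure (ρ : Measure Ω) (n T : ℕ) (C σ : ℝ) : Measure (Ω × (Fin T → Fin n → ℝ)) :=
  ρ.prod (Measure.pi fun _ => Measure.pi fun _ => gaussianReal 0 ((2 * C * σ) ^ 2).toNNReal)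

instance isProbabilityMeasure_noiseMeasure (ρ : Measure Ω) [IsProbabilityMeasure ρ] (n T : ℕ) (C σ : ℝ) :
    IsProbabilityMeasure (noiseMeasure ρ n T C σ) := by
  unfold noiseMeasure; infer_instance

lemma mechanism_eq (ρ : Measure Ω) (smp : Sampler N m s) (C σ : ℝ) (r : Fin N → Option X) :
    A.mechanism ρ smp E C σ r = ∑ x : Draw N m s E, drawProb smp x.1 x.2 •
      (noiseMeasure ρ n (E * roundsPerEpoch N m s) C σ).map
        fun p => A.transmitted C r x.1 x.2 p.1 p.2 := by
  rw [Fintype.sum_prod_type]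
  rfl

instance isProbabilityMeasure_mechanism (ρ : Measure Ω) [IsProbabilityMeasure ρ] (smp : Sampler N m s) (C σ : ℝ)
    (r : Fin N → Option X) : IsProbabilityMeasure (A.mechanism ρ smp E C σ r) := by
  refine ⟨?_⟩
  rw [mechanism_eq, Measure.finsetSum_apply]
  simp only [Measure.smul_apply, smul_eq_mul]
  have h : ∀ x : Draw N m s E, ((noiseMeasure ρ n (E * roundsPerEpoch N m s) C σ).map
      fun p => A.transmitted C r x.1 x.2 p.1 p.2) univ = 1 := fun x => by
    rw [Measure.map_apply (A.measurable_transmitted C r x) MeasurableSet.univ, preimage_univ,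
      measure_univ]
  simp only [h, mul_one]
  rw [Fintype.sum_prod_type, sum_drawProb]

lemma lintegral_mechanism (ρ : Measure Ω) [IsProbabilityMeasure ρ] (smp : Sampler N m s) (C σ : ℝ)
    (r : Fin N → Option X) {G : (Fin (E * roundsPerEpoch N m s) → ModelSpace n) → ℝ≥0∞}
    (hG : Measurable G) :
    ∫⁻ y, G y ∂A.mechanism ρ smp E C σ r = ∑ x : Draw N m s E, drawProb smp x.1 x.2 *
      ∫⁻ ω, ∫⁻ z, G (A.transmitted C r x.1 x.2 ω z) ∂Measure.pi
        (fun _ => Measure.pi fun _ => gaussianReal 0 ((2 * C * σ) ^ 2).toNNReal) ∂ρ := by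
  rw [mechanism_eq, lintegral_finsetSum_measure]
  refine Finset.sum_congr rfl fun x _ => ?_
  have hm := A.measurable_transmitted C r x
  rw [lintegral_smul_measure, lintegral_map hG hm, noiseMeasure,
    lintegral_prod (fun p => G (A.transmitted C r x.1 x.2 p.1 p.2)) (hG.comp hm).aemeasurable]
  rfl

/-- The law of the updates does not depend on how the samples are indexed. -/
lemma mechanism_comp_perm (ρ : Measure Ω) (smp : Sampler N m s) (C σ : ℝ) (r : Fin N → Option X)
    (τ : Equiv.Perm (Fin N)) :
    A.mechanism ρ smp E C σ (r ∘ τ) = A.mechanism ρ smp E C σ r := by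
  unfold mechanism
  -- Re-indexing `r ∘ τ` by `π` is re-indexing `r` by `τ * π`, and the uniform law is invariant
  -- under this substitution.
  refine Fintype.sum_equiv (Equiv.piCongrRight fun _ => Equiv.mulLeft τ) _ _ fun π => ?_
  refine Finset.sum_congr rfl fun S _ => ?_
  have hπ : (Equiv.piCongrRight fun _ : Fin E => Equiv.mulLeft τ) π = fun e => τ * π e := rfl
  rw [hπ, drawProb_mul_left]
  rfl

/-- The Bayes risk of testing the mechanism on two data sets whose representations agree from the
index `g` on. -/
lemma mixtureRisk_le_mechanism {ρ : Measure Ω} [IsProbabilityMeasure ρ] {smp : Sampler N m s}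
    {C σ : ℝ} (hC : 0 < C) (hσ : 0 < σ) {g : ℕ} {r r' : Fin N → Option X}
    (hr : ∀ i : Fin N, g ≤ i → r i = r' i)
    {φ : (Fin (E * roundsPerEpoch N m s) → ModelSpace n) → ℝ} (hφ : Measurable φ)
    (h01 : ∀ y, φ y ∈ Icc (0 : ℝ) 1) {k : ℝ} (hk : 0 ≤ k) :
    mixtureRisk (drawWeight (E := E) smp) (fun x => drawSens g x) σ k
      ≤ (1 - ∫ y, φ y ∂A.mechanism ρ smp E C σ r') + k * ∫ y, φ y ∂A.mechanism ρ smp E C σ r := by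
  have h₁ : Measurable fun y => ENNReal.ofReal (1 - φ y) := (measurable_const.sub hφ).ennreal_ofReal
  have h₂ : Measurable fun y => ENNReal.ofReal (φ y) := hφ.ennreal_ofReal
  have hQ := one_sub_integral_nonneg (A.mechanism ρ smp E C σ r') h01
  have hP : 0 ≤ ∫ y, φ y ∂A.mechanism ρ smp E C σ r := integral_nonneg fun y => (h01 y).1
  have hterm : ∀ x ∈ Finset.univ,
      0 ≤ drawWeight (E := E) smp x * gaussianRisk (drawSens g x / σ) k := fun x _ =>
    mul_nonneg ENNReal.toReal_nonneg (gaussianRisk_nonneg _ _)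
  refine (ENNReal.ofReal_le_ofReal_iff (add_nonneg hQ (mul_nonneg hk hP))).1 ?_
  rw [← lintegral_test_eq _ _ hφ h01 hk, lintegral_mechanism A ρ smp C σ r' h₁,
    lintegral_mechanism A ρ smp C σ r h₂, mixtureRisk, ENNReal.ofReal_sum_of_nonneg hterm, one_mul, Finset.mul_sum,
    ← Finset.sum_add_distrib]
  refine Finset.sum_le_sum fun x _ => ?_
  rw [ENNReal.ofReal_mul (p := drawWeight smp x) ENNReal.toReal_nonneg, ofReal_drawWeight, ofReal_gaussianRisk,
    mul_left_comm, ← mul_add]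
  -- Draws of probability zero may violate the disjointness of the sampled sets, but they carry no
  -- weight.
  rcases eq_or_ne (drawProb smp x.1 x.2) 0 with hx | hx
  · simp [hx]
  gcongr
  have hm₁ := (h₁.comp (A.measurable_transmitted C r' x)).lintegral_prod_right'
    (ν := Measure.pi fun _ => Measure.pi fun _ => gaussianReal 0 ((2 * C * σ) ^ 2).toNNReal)
  have hm₂ := (h₂.comp (A.measurable_transmitted C r x)).lintegral_prod_right'
    (ν := Measure.pi fun _ => Measure.pi fun _ => gaussianReal 0 ((2 * C * σ) ^ 2).toNNReal)
  simp only [Function.comp_def] at hm₁ hm₂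
  rw [← lintegral_const_mul _ hm₂, ← lintegral_add_right _ (hm₂.const_mul _)]
  calc gaussianBayes (drawSens g x / σ) 1 (ENNReal.ofReal k)
      = ∫⁻ _, gaussianBayes (drawSens g x / σ) 1 (ENNReal.ofReal k) ∂ρ := by simp
    _ ≤ _ := lintegral_mono fun ω => by
        have := A.gaussianBayes_le_transmitted hC hσ hx hr h₁ h₂
          (fun y => min_le_test (h01 y)) ω 1 (ENNReal.ofReal k)
        rwa [one_mul] at this

end LocalProgram

/-! ### Representations of data sets -/

lemma exists_perm_extending {N : ℕ} {p : Fin N → Prop} (f : {i // p i} → Fin N)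
    (hf : Function.Injective f) : ∃ τ : Equiv.Perm (Fin N), ∀ i (h : p i), τ i = f ⟨i, h⟩ := by
  classical
  refine ⟨(Equiv.ofInjective f hf).extendSubtype, fun i h => ?_⟩
  rw [Equiv.extendSubtype_apply_of_mem _ _ h]
  rfl

/-- Representations of two data sets can be re-indexed such that the common samples get the same
indices, and these are the indices from `g` on. -/
lemma exists_perm_agree {X : Type*} [DecidableEq X] {N g : ℕ} {d d' : Finset X}
    {r r' : Fin N → Option X} (hr : Represents r d) (hr' : Represents r' d')
    (hN : N = (d ∩ d').card + g) :
    ∃ τ τ' : Equiv.Perm (Fin N), ∀ i : Fin N, g ≤ i → (r ∘ τ) i = (r' ∘ τ') i := by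
  classical
  -- By `N = |d ∩ d'| + g` the common samples fill the indices from `g` on exactly; the bijection
  -- `κ` fixes their order for both representations.
  have hcard : Fintype.card {i : Fin N // g ≤ i} = Fintype.card ↥(d ∩ d') := by
    have h : Fintype.card {i : Fin N // ¬ (i : ℕ) < g} = N - g := by
      rw [Fintype.card_subtype_compl, Fintype.card_fin]
      congr 1
      rw [Fintype.card_subtype, Fin.card_filter_val_lt]
      omega
    simp only [not_lt] at h
    rw [h, Fintype.card_coe]
    omega
  obtain ⟨κ⟩ := Fintype.card_eq.1 hcard
  have key : ∀ (q : Fin N → Option X) (D : Finset X), Represents q D → d ∩ d' ⊆ D →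
      ∃ τ : Equiv.Perm (Fin N), ∀ (i : Fin N) (h : g ≤ i), q (τ i) = some (κ ⟨i, h⟩ : X) := by
    intro q D hq hD
    have hex : ∀ i : {i : Fin N // g ≤ i}, ∃ j, q j = some (κ i : X) := fun i =>
      (hq.mem_iff _).1 (hD (κ i).2)
    choose f hf using hex
    obtain ⟨τ, hτ⟩ := exists_perm_extending f fun i j hij => by
      have h := hf i
      rw [hij, hf j] at h
      exact κ.injective (Subtype.ext (Option.some_injective _ h)).symm
    exact ⟨τ, fun i h => by rw [hτ i h, hf]⟩
  obtain ⟨τ, hτ⟩ := key r d hr Finset.inter_subset_left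
  obtain ⟨τ', hτ'⟩ := key r' d' hr' Finset.inter_subset_right
  exact ⟨τ, τ', fun i h => by rw [Function.comp_apply, Function.comp_apply, hτ i h, hτ' i h]⟩

lemma isGroupDP_mechanism {X Ω : Type*} [DecidableEq X] [MeasurableSpace Ω] (ρ : Measure Ω)
    [IsProbabilityMeasure ρ] {n N m s : ℕ} (E : ℕ) {C σ : ℝ} (hC : 0 < C) (hσ : 0 < σ)
    (smp : Sampler N m s) (A : LocalProgram X Ω n N) (g : ℕ) :
    IsGroupDP (A.mechanism ρ smp E C σ) g (sampledTradeoff smp E g σ) := by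
  have hlaw := hasFiniteLaw_sensProb smp E g
  refine ⟨(hlaw.isSymmetricTradeoffFunction_mixtureTradeoff hσ).toIsTradeoffFunction,
    fun d d' _ hN r r' hr hr' α hα => ?_⟩
  obtain ⟨τ, τ', hagree⟩ := exists_perm_agree hr hr' hN
  rw [← A.mechanism_comp_perm ρ smp C σ r τ, ← A.mechanism_comp_perm ρ smp C σ r' τ']
  refine le_tradeoff _ _ hα.1 fun φ hφ h01 hle => ?_
  refine ((hlaw.isConjugate_mixtureTradeoff hσ).le_iff hα).2 fun k hk => ?_
  have := A.mixtureRisk_le_mechanism (ρ := ρ) (smp := smp) (E := E) hC hσ hagree hφ h01 hk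
  linarith [mul_le_mul_of_nonneg_left hle hk]

end

theorem theorem2 {X Ω : Type*} [DecidableEq X] [MeasurableSpace Ω]
    (ρ : Measure Ω) [IsProbabilityMeasure ρ] (n N m s E : ℕ) (C σ : ℝ) (hC : 0 < C) (hσ : 0 < σ)
    (smp : Sampler N m s) (A : LocalProgram X Ω n N) (g : ℕ) :
    -- `f` is well defined by its closed form, and is the infimum over the mixture
    (∀ α ∈ Icc (0 : ℝ) 1,
      (∃ Λ θ, IsThreshold (sensSet g) (sensProb smp E g) σ α Λ θ) ∧
      (∀ Λ θ, IsThreshold (sensSet g) (sensProb smp E g) σ α Λ θ →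
        sampledTradeoff smp E g σ α = thresholdValue (sensSet g) (sensProb smp E g) σ Λ θ) ∧
      IsGLB {v : ℝ | ∃ a : sensSet g → ℝ, (∀ c, a c ∈ Icc (0 : ℝ) 1) ∧
          ∑' c : sensSet g, sensProb smp E g c * a c = α ∧
          v = ∑' c : sensSet g, sensProb smp E g c * gaussianTradeoff (c / σ) (a c)}
        (sampledTradeoff smp E g σ α)) ∧
    -- the mechanism is `f`-DP
    IsGroupDP (A.mechanism ρ smp E C σ) g (sampledTradeoff smp E g σ) ∧
    -- `f` is a symmetric trade-off function
    IsSymmetricTradeoffFunction (sampledTradeoff smp E g σ) ∧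
    -- the lower bounds
    (∀ cL l : ℝ, 0 ≤ cL → l ≤ 1 →
      ∑' c : {c : ℝ | c ∈ sensSet g ∧ cL < c}, sensProb smp E g c ≤ l →
      (∀ α ∈ Icc (0 : ℝ) 1,
        lowerBound σ cL l α ≤ sampledTradeoff smp E g σ α ∧
        lowerHat σ cL l α ≤ lowerBound σ cL l α) ∧
      IsSymmetricTradeoffFunction (lowerBound σ cL l) ∧
      ∃ β ∈ Icc (0 : ℝ) 1,
        (∀ x ∈ Icc (0 : ℝ) 1, gaussianTradeoff (cL / σ) x - l = x ↔ x = β) ∧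
        (∀ α ∈ Icc 0 β, lowerBound σ cL l α = gaussianTradeoff (cL / σ) α - l) ∧
        (∀ α ∈ Icc β 1, lowerBound σ cL l α = gaussianTradeoff (cL / σ) (min 1 (α + l)))) ∧
    -- `f` decreases as `g` grows
    (∀ g' : ℕ, g ≤ g' → ∀ α ∈ Icc (0 : ℝ) 1,
      sampledTradeoff smp E g' σ α ≤ sampledTradeoff smp E g σ α) := by
  have hlaw := hasFiniteLaw_sensProb smp E g
  refine ⟨fun α hα => ?_, isGroupDP_mechanism ρ E hC hσ smp A g,
    hlaw.isSymmetricTradeoffFunction_mixtureTradeoff hσ, fun cL l hcL hl1 hl => ?_,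
    fun g' hg α hα => sampledTradeoff_anti smp hσ hg hα⟩
  · obtain ⟨Λ, θ, hΛ⟩ := hlaw.exists_isThreshold hσ hα
    refine ⟨⟨Λ, θ, hΛ⟩, fun Λ' θ' hΛ' => hlaw.mixtureTradeoff_eq hσ hΛ', ?_⟩
    rw [sampledTradeoff, hlaw.mixtureTradeoff_eq hσ hΛ]
    exact hlaw.isGLB_thresholdValue hσ hΛ
  · classical
    rw [tsum_sensProb_gt] at hl
    have hl0 : 0 ≤ l := (Finset.sum_nonneg fun x _ => by
      split_ifs
      exacts [hlaw.nonneg x, le_rfl]).trans hl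
    have hμ : 0 ≤ cL / σ := div_nonneg hcL hσ.le
    exact ⟨fun α hα => ⟨hlaw.lowerBound_le_mixtureTradeoff hσ hcL hl0 hl hα, le_max_left _ _⟩,
      isSymmetricTradeoffFunction_lowerBound hμ hl0, exists_crossover hμ hl0 hl1⟩
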